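/- Let $(M,J)$ be a compact connected complex manifold, $g$ a smooth Hermitian metric on it, and $h_1,h_2$ smooth fields of $g$-symmetric endomorphisms of $TM$ commuting with $J$. **Conventions.** $\omega=g(J\cdot,\cdot)$; $D^g$ is the Levi-Civita connection; $\nabla$ is the Chern connection, $g(\nabla_XY,Z)=g(D^g_XY,Z)-\tfrac12 d\omega(JX,Y,Z)$, with torsion $T$; $\vartheta(X)=\operatorname{tr}^{\mathbb R}T(X,\cdot)$ is the Lee form; $\Omega(X,Y)=\nabla_{[X,Y]}-[\nabla_X,\nabla_Y]$. For a symmetric endomorphism $h$ commuting with $J$, $\operatorname{tr}^{\mathbb C}h=\tfrac12\operatorname{tr}^{\mathbb R}h$ and $\rho_g(h)=g((J\circ h)\cdot,\cdot)$. Further, $\tilde S(X,Y)=-\operatorname{tr}^{\mathbb C}(J\circ\Omega(X,Y))$, $S(g)=\rho_g^{-1}(\tilde S)$ and $\operatorname{scal}^{\rm Ch}(g)=2\operatorname{tr}^{\mathbb C}S(g)$. For a function $u$, $g(\operatorname{Hess}_g(u)X,Y)=(D^g_Xdu)(Y)$ and $dd^cu(X,Y)=X(JY(u))-Y(JX(u))-J[X,Y](u)$,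 i.e. $d^cu=du\circ J$. The divergences are $(\delta_gh)(X)=\operatorname{tr}^{\mathbb R}(Z\mapsto(D^g_Zh)X)$ and $(\delta^\nabla h)(X)=\operatorname{tr}^{\mathbb R}(Z\mapsto(\nabla_Zh)X)$. On covectors and endomorphisms $g$ denotes the induced scalar products; $\operatorname{Ric}(g)$ is the Riemannian Ricci endomorphism. **Differentials.** For a $J$-invariant metric $g'$ and a field $h$ of endomorphisms commuting with $J$, let $(\operatorname{scal}^{\rm Ch})'_{g'}(h)=\frac{d}{ds}\big|_{s=0}\operatorname{scal}^{\rm Ch}(g'_s)$, where $g'_s$ is the symmetric part of $g'((\mathrm{Id}+sh)\cdot,\cdot)$ (which is symmetric already if $h$ is $g'$-symmetric). The second differential at $g$ in the direction of $(h_1,h_2)$ is the derivative of the first one with the endomorphism field $h_1$ kept fixed: $$(\operatorname{scal}^{\rm Ch})''(h_1,h_2)=\frac{d}{dt}\Big|_{t=0}(\operatorname{scal}^{\rm Ch})'_{g_t}(h_1),\qquad g_t=g((\mathrm{Id}+th_2)\cdot,\cdot).$$ **Statement.** At every point of $M$, $(\operatorname{scal}^{\rm Ch})'_{g_t}(h_1)$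 exists for all small $t$ and is differentiable in $t$ at $t=0$, and $$(\operatorname{scal}^{\rm Ch})''(h_1,h_2)=g(\operatorname{Hess}_g(\operatorname{tr}^{\mathbb C}h_1),h_2)+g(d(\operatorname{tr}^{\mathbb C}h_1),\delta_gh_2-\delta^\nabla h_2)-g(d(\operatorname{tr}^{\mathbb C}h_1),\vartheta\circ h_2)+g(h_1,h_2\circ S(g))-\tfrac12 g\big(h_1,\rho_g^{-1}(dd^c(\operatorname{tr}^{\mathbb C}h_2))\big).$$ Moreover, if $g$ is Kähler (that is, $d\omega=0$), then $$(\operatorname{scal}^{\rm Ch})''(h_1,h_2)=g(\operatorname{Hess}_g(\operatorname{tr}^{\mathbb C}h_1),h_2)+g(h_1,\operatorname{Hess}_g(\operatorname{tr}^{\mathbb C}h_2))+g(h_1,h_2\circ\operatorname{Ric}(g)).$$ -/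

import Mathlib

open scoped Manifold ContDiff Topology

set_option maxSynthPendingDepth 3

noncomputable section

namespace ChernVariation

/-! ### Linear algebra

`V` is a real vector space, `B` a scalar product and `J` a linear complex structure on it. -/

section LinearAlgebra

variable {V : Type*} [NormedAddCommGroup V] [NormedSpace ℝ V]

/-- Exchange of the last two arguments: `swapLast T X Y Z = T X Z Y`. -/
def swapLast {F : Type*} [NormedAddCommGroup F] [NormedSpace ℝ F]
    (T : V →L[ℝ] V →L[ℝ] V →L[ℝ] F) : V →L[ℝ] V →L[ℝ] V →L[ℝ] F :=
  ((ContinuousLinearMap.flipₗᵢ ℝ V V F).toContinuousLinearEquiv :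
    (V →L[ℝ] V →L[ℝ] F) →L[ℝ] (V →L[ℝ] V →L[ℝ] F)) ∘L T

@[simp] theorem swapLast_apply {F : Type*} [NormedAddCommGroup F] [NormedSpace ℝ F]
    (T : V →L[ℝ] V →L[ℝ] V →L[ℝ] F) (X Y Z : V) : swapLast T X Y Z = T X Z Y := rfl

/-- The isomorphism `V^* → V` inverse to `X ↦ B(X, ·)`, for a nondegenerate `B`. -/
def sharp (B : V →L[ℝ] V →L[ℝ] ℝ) : (V →L[ℝ] ℝ) →L[ℝ] V := ContinuousLinearMap.inverse B

/-- The endomorphism `A` with `B(A X, Y) = b(X, Y)`. -/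
def raise (B b : V →L[ℝ] V →L[ℝ] ℝ) : V →L[ℝ] V := sharp B ∘L b

/-- The bilinear map `Γ` with `B(Γ(X, Y), Z) = T(X, Y, Z)`. -/
def raiseLast (B : V →L[ℝ] V →L[ℝ] ℝ) (T : V →L[ℝ] V →L[ℝ] V →L[ℝ] ℝ) : V →L[ℝ] V →L[ℝ] V :=
  ContinuousLinearMap.compL ℝ V (V →L[ℝ] ℝ) V (sharp B) ∘L T

@[simp] theorem raiseLast_apply (B : V →L[ℝ] V →L[ℝ] ℝ) (T : V →L[ℝ] V →L[ℝ] V →L[ℝ] ℝ)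
    (X Y : V) : raiseLast B T X Y = sharp B (T X Y) := rfl

/-- The `B`-adjoint of `A`: `B(A^* X, Y) = B(X, A Y)`. -/
def adj (B : V →L[ℝ] V →L[ℝ] ℝ) (A : V →L[ℝ] V) : V →L[ℝ] V :=
  sharp B ∘L ContinuousLinearMap.precomp ℝ A ∘L B

/-- The scalar product induced on covectors. -/
def innerCov (B : V →L[ℝ] V →L[ℝ] ℝ) (a b : V →L[ℝ] ℝ) : ℝ := a (sharp B b)

/-- The map `h ↦ ρ(h) = B((J ∘ h)·, ·)` from endomorphisms to bilinear forms. -/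
def rho (J : V →L[ℝ] V) (B : V →L[ℝ] V →L[ℝ] ℝ) (h : V →L[ℝ] V) : V →L[ℝ] V →L[ℝ] ℝ :=
  B ∘L J ∘L h

/-- The inverse of `ρ`: the endomorphism `h` with `B(h X, Y) = α(X, J Y)`. For a `J`-invariant
form `α` and a `J`-invariant `B` this says `B(J h X, Y) = α(X, Y)`. -/
def rhoInv (J : V →L[ℝ] V) (B α : V →L[ℝ] V →L[ℝ] ℝ) : V →L[ℝ] V :=
  raise B (ContinuousLinearMap.precomp ℝ J ∘L α)

/-- The symmetric part of a bilinear form. -/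
def symPart (b : V →L[ℝ] V →L[ℝ] ℝ) : V →L[ℝ] V →L[ℝ] ℝ := (1 / 2 : ℝ) • (b + b.flip)

variable [FiniteDimensional ℝ V]

/-- The real trace of an endomorphism. -/
def trR : (V →L[ℝ] V) →L[ℝ] ℝ :=
  LinearMap.toContinuousLinearMap (LinearMap.trace ℝ V ∘ₗ ContinuousLinearMap.coeLM ℝ)

@[simp] theorem trR_apply (A : V →L[ℝ] V) :
    trR A = LinearMap.trace ℝ V (A : V →ₗ[ℝ] V) := rfl

/-- The complex trace of a symmetric endomorphism commuting with `J` (a real number): half of its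
real trace. -/
def trC : (V →L[ℝ] V) →L[ℝ] ℝ := (1 / 2 : ℝ) • trR

/-- The scalar product `tr(A^* C)` induced on endomorphisms. -/
def innerEnd (B : V →L[ℝ] V →L[ℝ] ℝ) (A C : V →L[ℝ] V) : ℝ := trR (adj B A ∘L C)

end LinearAlgebra

/-! ### Local geometry

`G` is a metric on an open set of `V`, i.e. a bilinear form depending on the point, and `J` is a
complex structure of `V`. Tensors at the point `z` are evaluated on vectors of `V`, which are
extended to constant vector fields. -/

section LocalGeometry

variable {V : Type*} [NormedAddCommGroup V] [NormedSpace ℝ V]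

/-- The exterior derivative of a `1`-form. -/
def dOne (a : V → V →L[ℝ] ℝ) (z : V) : V →L[ℝ] V →L[ℝ] ℝ :=
  fderiv ℝ a z - (fderiv ℝ a z).flip

/-- The exterior derivative of a `2`-form. -/
def dTwo (w : V → V →L[ℝ] V →L[ℝ] ℝ) (z : V) : V →L[ℝ] V →L[ℝ] V →L[ℝ] ℝ :=
  fderiv ℝ w z - (fderiv ℝ w z).flip + swapLast (fderiv ℝ w z).flip

/-- `dw(X, Y, Z) = X w(Y, Z) - Y w(X, Z) + Z w(X, Y)` on constant vector fields. -/
theorem dTwo_apply (w : V → V →L[ℝ] V →L[ℝ] ℝ) (z X Y Z : V) :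
    dTwo w z X Y Z = fderiv ℝ w z X Y Z - fderiv ℝ w z Y X Z + fderiv ℝ w z Z X Y := rfl

/-- `dd^c u` with `d^c u = J⁻¹ du = du ∘ J`. -/
def ddcLoc (J : V →L[ℝ] V) (u : V → ℝ) (z : V) : V →L[ℝ] V →L[ℝ] ℝ :=
  dOne (fun y => fderiv ℝ u y ∘L J) z

/-- The fundamental form `ω = ρ(Id)`, i.e. `ω(X, Y) = g(J X, Y)`. -/
def fundFormLoc (J : V →L[ℝ] V) (G : V → V →L[ℝ] V →L[ℝ] ℝ) (z : V) : V →L[ℝ] V →L[ℝ] ℝ :=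
  rho J (G z) (ContinuousLinearMap.id ℝ V)

/-- `g(D_X Y, Z)` for the Levi-Civita connection `D` and constant vector fields. -/
def leviCivitaForm (G : V → V →L[ℝ] V →L[ℝ] ℝ) (z : V) : V →L[ℝ] V →L[ℝ] V →L[ℝ] ℝ :=
  (1 / 2 : ℝ) • (fderiv ℝ G z + (fderiv ℝ G z).flip - swapLast (fderiv ℝ G z).flip)

/-- The Koszul formula for constant vector fields. -/
theorem leviCivitaForm_apply (G : V → V →L[ℝ] V →L[ℝ] ℝ) (z X Y Z : V) :
    leviCivitaForm G z X Y Z =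
      1 / 2 * (fderiv ℝ G z X Y Z + fderiv ℝ G z Y X Z - fderiv ℝ G z Z X Y) := rfl

/-- `g(∇_X Y, Z) = g(D_X Y, Z) - ½ dω(J X, Y, Z)` for the Chern connection `∇` and constant vector
fields. -/
def chernForm (J : V →L[ℝ] V) (G : V → V →L[ℝ] V →L[ℝ] ℝ) (z : V) :
    V →L[ℝ] V →L[ℝ] V →L[ℝ] ℝ :=
  leviCivitaForm G z - (1 / 2 : ℝ) • (dTwo (fundFormLoc J G) z ∘L J)

/-- The Christoffel symbol `D_X Y` of the Levi-Civita connection. -/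
def leviCivita (G : V → V →L[ℝ] V →L[ℝ] ℝ) (z : V) : V →L[ℝ] V →L[ℝ] V :=
  raiseLast (G z) (leviCivitaForm G z)

/-- The Christoffel symbol `∇_X Y` of the Chern connection. -/
def chernConn (J : V →L[ℝ] V) (G : V → V →L[ℝ] V →L[ℝ] ℝ) (z : V) : V →L[ℝ] V →L[ℝ] V :=
  raiseLast (G z) (chernForm J G z)

/-- The torsion of the connection with Christoffel symbol `Γ`. -/
def torsion (Γ : V → V →L[ℝ] V →L[ℝ] V) (z : V) : V →L[ℝ] V →L[ℝ] V := Γ z - (Γ z).flip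

/-- `∇_X (∇_Y W)` for constant vector fields, as a function of `X`, `Y`, `W`. -/
def secondDer (Γ : V → V →L[ℝ] V →L[ℝ] V) (z : V) : V →L[ℝ] V →L[ℝ] V →L[ℝ] V :=
  fderiv ℝ Γ z + (ContinuousLinearMap.compL ℝ V V V).bilinearComp (Γ z) (Γ z)

theorem secondDer_apply (Γ : V → V →L[ℝ] V →L[ℝ] V) (z X Y W : V) :
    secondDer Γ z X Y W = fderiv ℝ Γ z X Y W + Γ z X (Γ z Y W) := rfl

/-- The curvature `[∇_X, ∇_Y] - ∇_[X,Y]` of the connection with Christoffel symbol `Γ`. -/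
def curv (Γ : V → V →L[ℝ] V →L[ℝ] V) (z : V) : V →L[ℝ] V →L[ℝ] V →L[ℝ] V :=
  secondDer Γ z - (secondDer Γ z).flip

/-- The Chern curvature operator `Ω(X, Y) = ∇_[X,Y] - [∇_X, ∇_Y]`. -/
def chernCurv (J : V →L[ℝ] V) (G : V → V →L[ℝ] V →L[ℝ] ℝ) (z : V) :
    V →L[ℝ] V →L[ℝ] V →L[ℝ] V :=
  -curv (chernConn J G) z

/-- The covariant derivative of an endomorphism field. -/
def covDerEnd (Γ : V → V →L[ℝ] V →L[ℝ] V) (H : V → V →L[ℝ] V) (z : V) :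
    V →L[ℝ] V →L[ℝ] V :=
  fderiv ℝ H z + (ContinuousLinearMap.compL ℝ V V V).flip (H z) ∘L Γ z
    - ContinuousLinearMap.compL ℝ V V V (H z) ∘L Γ z

/-- `(∇_X H)(Y) = ∇_X (H Y) - H (∇_X Y)` for constant `X`, `Y`. -/
theorem covDerEnd_apply (Γ : V → V →L[ℝ] V →L[ℝ] V) (H : V → V →L[ℝ] V) (z X Y : V) :
    covDerEnd Γ H z X Y = fderiv ℝ H z X Y + Γ z X (H z Y) - H z (Γ z X Y) := rfl

/-- The endomorphism `Hess(u)` with `g(Hess(u) X, Y) = (D_X du)(Y)`. -/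
def hessLoc (G : V → V →L[ℝ] V →L[ℝ] ℝ) (u : V → ℝ) (z : V) : V →L[ℝ] V :=
  raise (G z) (fderiv ℝ (fderiv ℝ u) z
    - ContinuousLinearMap.compL ℝ V V ℝ (fderiv ℝ u z) ∘L leviCivita G z)

variable [FiniteDimensional ℝ V]

/-- The Lee form `ϑ(X) = tr T(X, ·)`, with `T` the torsion of the Chern connection. -/
def leeLoc (J : V →L[ℝ] V) (G : V → V →L[ℝ] V →L[ℝ] ℝ) (z : V) : V →L[ℝ] ℝ :=
  trR ∘L torsion (chernConn J G) z

/-- The first Chern-Ricci form `(X, Y) ↦ -tr^C(J ∘ Ω(X, Y))`. -/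
def chernRicciForm (J : V →L[ℝ] V) (G : V → V →L[ℝ] V →L[ℝ] ℝ) (z : V) :
    V →L[ℝ] V →L[ℝ] ℝ :=
  -(ContinuousLinearMap.compL ℝ V (V →L[ℝ] V) ℝ
      (trC ∘L ContinuousLinearMap.compL ℝ V V V J) ∘L chernCurv J G z)

theorem chernRicciForm_apply (J : V →L[ℝ] V) (G : V → V →L[ℝ] V →L[ℝ] ℝ) (z X Y : V) :
    chernRicciForm J G z X Y = -trC (J ∘L chernCurv J G z X Y) := rfl

/-- The first Chern-Ricci symmetric endomorphism. -/
def chernRicciLoc (J : V →L[ℝ] V) (G : V → V →L[ℝ] V →L[ℝ] ℝ) (z : V) : V →L[ℝ] V :=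
  rhoInv J (G z) (chernRicciForm J G z)

/-- The Chern-scalar curvature: twice the complex trace of the first Chern-Ricci form. -/
def chernScalLoc (J : V →L[ℝ] V) (G : V → V →L[ℝ] V →L[ℝ] ℝ) (z : V) : ℝ :=
  2 * trC (rhoInv J (G z) (chernRicciForm J G z))

/-- The Riemannian Ricci form `(X, Y) ↦ tr (Z ↦ R(Z, X) Y)`. -/
def ricciForm (G : V → V →L[ℝ] V →L[ℝ] ℝ) (z : V) : V →L[ℝ] V →L[ℝ] ℝ :=
  ContinuousLinearMap.compL ℝ V (V →L[ℝ] V) ℝ trR ∘L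
    swapLast (curv (leviCivita G) z).flip

theorem ricciForm_apply (G : V → V →L[ℝ] V →L[ℝ] ℝ) (z X Y : V) :
    ricciForm G z X Y = trR (((curv (leviCivita G) z).flip X).flip Y) := rfl

/-- The Riemannian Ricci endomorphism. -/
def ricciLoc (G : V → V →L[ℝ] V →L[ℝ] ℝ) (z : V) : V →L[ℝ] V := raise (G z) (ricciForm G z)

/-- The divergence `X ↦ tr (Z ↦ (∇_Z H)(X))` of an endomorphism field, for the connection with
Christoffel symbol `Γ`. -/
def divLoc (Γ : V → V →L[ℝ] V →L[ℝ] V) (H : V → V →L[ℝ] V) (z : V) : V →L[ℝ] ℝ :=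
  trR ∘L (covDerEnd Γ H z).flip

end LocalGeometry

/-! ### Complex manifolds

`M` is a complex manifold modelled on `E`. The real tangent space `TangentSpace 𝓘(ℝ, E) x` is `E`
by means of the preferred holomorphic chart at `x`; geometric objects at `x` are computed in that
chart. -/

section Manifold

/-- A complex manifold is a real smooth manifold. -/
instance isManifold_real {E : Type*} [NormedAddCommGroup E] [NormedSpace ℂ E]
    {M : Type*} [TopologicalSpace M] [ChartedSpace E M] [IsManifold 𝓘(ℂ, E) ω M] :
    IsManifold 𝓘(ℝ, E) ∞ M := by
  refine isManifold_of_contDiffOn _ _ _ fun e e' he he' => ?_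
  have h := (contDiffGroupoid ω 𝓘(ℂ, E)).compatible he he'
  rw [contDiffGroupoid, mem_groupoid_of_pregroupoid] at h
  have h2 : ContDiffOn ℂ ω (𝓘(ℂ, E) ∘ (e.symm ≫ₕ e') ∘ 𝓘(ℂ, E).symm)
    (𝓘(ℂ, E).symm ⁻¹' (e.symm ≫ₕ e').source ∩ Set.range 𝓘(ℂ, E)) := h.1
  exact (h2.restrict_scalars ℝ).of_le le_top

/-- For a complex linear map, `trC` is the real part of the complex trace. -/
theorem trC_restrictScalars {E : Type*} [NormedAddCommGroup E] [NormedSpace ℂ E]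
    [FiniteDimensional ℂ E] (A : E →L[ℂ] E) :
    trC (A.restrictScalars ℝ) = (LinearMap.trace ℂ E (A : E →ₗ[ℂ] E)).re := by
  have b := Module.finBasis ℂ E
  have h : LinearMap.trace ℝ E (A.restrictScalars ℝ : E →L[ℝ] E) =
      2 * (LinearMap.trace ℂ E (A : E →ₗ[ℂ] E)).re := by
    rw [LinearMap.trace_eq_matrix_trace ℂ b,
      LinearMap.trace_eq_matrix_trace ℝ (Complex.basisOneI.smulTower b)]
    simp [Matrix.trace, Fintype.sum_prod_type, LinearMap.toMatrix_apply,
      Module.Basis.smulTower_repr, Module.Basis.smulTower_apply, two_mul]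
  change (1 / 2 : ℝ) * LinearMap.trace ℝ E (A.restrictScalars ℝ : E →L[ℝ] E) = _
  rw [h]
  ring

variable {E : Type*} [NormedAddCommGroup E] [NormedSpace ℂ E]
  {M : Type*} [TopologicalSpace M] [ChartedSpace E M]

/-- Multiplication by `i`, as a real endomorphism of `E`. -/
def cplxStr : E →L[ℝ] E :=
  (Complex.I • ContinuousLinearMap.id ℂ E).restrictScalars ℝ

@[simp] theorem cplxStr_apply (v : E) : cplxStr v = Complex.I • v := rfl

variable (E) in
/-- Fields of real bilinear forms on the tangent spaces. -/
abbrev BilinField (M : Type*) [TopologicalSpace M] [ChartedSpace E M] : Type _ :=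
  ∀ x : M, TangentSpace 𝓘(ℝ, E) x →L[ℝ] TangentSpace 𝓘(ℝ, E) x →L[ℝ] ℝ

variable (E) in
/-- Fields of real endomorphisms of the tangent spaces. -/
abbrev EndField (M : Type*) [TopologicalSpace M] [ChartedSpace E M] : Type _ :=
  ∀ x : M, TangentSpace 𝓘(ℝ, E) x →L[ℝ] TangentSpace 𝓘(ℝ, E) x

/-- The complex structure of the tangent space at `x`. -/
def almostCplx (x : M) : TangentSpace 𝓘(ℝ, E) x →L[ℝ] TangentSpace 𝓘(ℝ, E) x :=
  (cplxStr : E →L[ℝ] E)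

/-- `g` is a smooth Hermitian metric. -/
structure IsHermitianMetric [IsManifold 𝓘(ℂ, E) ω M] (g : BilinField E M) : Prop where
  symm : ∀ x v w, g x v w = g x w v
  pos : ∀ x v, v ≠ 0 → 0 < g x v v
  invariant : ∀ x v w, g x (almostCplx x v) (almostCplx x w) = g x v w
  smooth : ContMDiff 𝓘(ℝ, E) (𝓘(ℝ, E).prod 𝓘(ℝ, E →L[ℝ] E →L[ℝ] ℝ)) ∞
    (fun x => Bundle.TotalSpace.mk' (E →L[ℝ] E →L[ℝ] ℝ)
      (E := fun x : M => TangentSpace 𝓘(ℝ, E) x →L[ℝ] TangentSpace 𝓘(ℝ, E) x →L[ℝ] ℝ) x (g x))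

/-- `h` is a smooth field of `g`-symmetric endomorphisms commuting with `J`. -/
structure IsSymInvariant [IsManifold 𝓘(ℂ, E) ω M] (g : BilinField E M) (h : EndField E M) :
    Prop where
  symm : ∀ x v w, g x (h x v) w = g x v (h x w)
  comm : ∀ x v, h x (almostCplx x v) = almostCplx x (h x v)
  smooth : ContMDiff 𝓘(ℝ, E) (𝓘(ℝ, E).prod 𝓘(ℝ, E →L[ℝ] E)) ∞
    (fun x => Bundle.TotalSpace.mk' (E →L[ℝ] E)
      (E := fun x : M => TangentSpace 𝓘(ℝ, E) x →L[ℝ] TangentSpace 𝓘(ℝ, E) x) x (h x))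

/-- The bilinear field `g` read in the holomorphic chart at `c`: its pullback by the inverse of
the chart. -/
def chartMetric (g : BilinField E M) (c : M) (z : E) : E →L[ℝ] E →L[ℝ] ℝ :=
  let ψ := (extChartAt 𝓘(ℝ, E) c).symm
  let A : E →L[ℝ] E := mfderiv 𝓘(ℝ, E) 𝓘(ℝ, E) ψ z
  ContinuousLinearMap.bilinearComp (show E →L[ℝ] E →L[ℝ] ℝ from g (ψ z)) A A

/-- The endomorphism field `h` read in the holomorphic chart at `c`. -/
def chartEnd (h : EndField E M) (c : M) (z : E) : E →L[ℝ] E :=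
  let ψ := (extChartAt 𝓘(ℝ, E) c).symm
  let A : E →L[ℝ] E := mfderiv 𝓘(ℝ, E) 𝓘(ℝ, E) ψ z
  ContinuousLinearMap.inverse A ∘L (show E →L[ℝ] E from h (ψ z)) ∘L A

/-- The function `u` read in the holomorphic chart at `c`. -/
def chartFun (u : M → ℝ) (c : M) (z : E) : ℝ := u ((extChartAt 𝓘(ℝ, E) c).symm z)

/-- The exterior derivative of the fundamental form of `g` at `x`. -/
def dFundForm (g : BilinField E M) (x : M) : E →L[ℝ] E →L[ℝ] E →L[ℝ] ℝ :=
  dTwo (fundFormLoc cplxStr (chartMetric g x)) (extChartAt 𝓘(ℝ, E) x x)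

/-- `g` is Kähler: its fundamental form is closed. -/
def IsKaehler (g : BilinField E M) : Prop := ∀ x : M, dFundForm g x = 0

/-- The Hessian endomorphism of `u` at `x`. -/
def hess (g : BilinField E M) (u : M → ℝ) (x : M) :
    TangentSpace 𝓘(ℝ, E) x →L[ℝ] TangentSpace 𝓘(ℝ, E) x :=
  hessLoc (chartMetric g x) (chartFun u x) (extChartAt 𝓘(ℝ, E) x x)

/-- The differential of `u` at `x`. -/
def diff (u : M → ℝ) (x : M) : TangentSpace 𝓘(ℝ, E) x →L[ℝ] ℝ :=
  mfderiv 𝓘(ℝ, E) 𝓘(ℝ, ℝ) u x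

/-- The form `dd^c u` at `x`. -/
def ddc (u : M → ℝ) (x : M) : TangentSpace 𝓘(ℝ, E) x →L[ℝ] TangentSpace 𝓘(ℝ, E) x →L[ℝ] ℝ :=
  ddcLoc (V := E) cplxStr (chartFun u x) (extChartAt 𝓘(ℝ, E) x x)

/-- The scalar product induced by `g` on covectors at `x`. -/
def innerCovAt (g : BilinField E M) (x : M) (a b : TangentSpace 𝓘(ℝ, E) x →L[ℝ] ℝ) : ℝ :=
  innerCov (V := E) (g x) a b

/-- The inverse of `h ↦ g((J ∘ h)·, ·)` at `x`. -/
def rhoInvAt (g : BilinField E M) (x : M)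
    (α : TangentSpace 𝓘(ℝ, E) x →L[ℝ] TangentSpace 𝓘(ℝ, E) x →L[ℝ] ℝ) :
    TangentSpace 𝓘(ℝ, E) x →L[ℝ] TangentSpace 𝓘(ℝ, E) x :=
  rhoInv (V := E) cplxStr (g x) α

/-- The field of bilinear forms `g((Id + s h)·, ·)`, symmetrized. The symmetrization has no effect
if `h` is `g`-symmetric. -/
def vary (g : BilinField E M) (h : EndField E M) (s : ℝ) : BilinField E M := fun x =>
  symPart (V := E) (g x ∘L (ContinuousLinearMap.id ℝ (TangentSpace 𝓘(ℝ, E) x) + s • h x))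

variable [FiniteDimensional ℂ E]

/-- The scalar product induced by `g` on endomorphisms at `x`. -/
def innerEndAt (g : BilinField E M) (x : M)
    (A C : TangentSpace 𝓘(ℝ, E) x →L[ℝ] TangentSpace 𝓘(ℝ, E) x) : ℝ :=
  innerEnd (V := E) (g x) A C

/-- The complex trace of an endomorphism field, as a function on `M`. -/
def trCField (h : EndField E M) (x : M) : ℝ := trC (V := E) (h x)

/-- The Lee form of `g` at `x`. -/
def lee (g : BilinField E M) (x : M) : TangentSpace 𝓘(ℝ, E) x →L[ℝ] ℝ :=
  leeLoc (V := E) cplxStr (chartMetric g x) (extChartAt 𝓘(ℝ, E) x x)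

/-- The divergence of `h` at `x` for the Levi-Civita connection of `g`. -/
def divLC (g : BilinField E M) (h : EndField E M) (x : M) : TangentSpace 𝓘(ℝ, E) x →L[ℝ] ℝ :=
  divLoc (V := E) (leviCivita (chartMetric g x)) (chartEnd h x) (extChartAt 𝓘(ℝ, E) x x)

/-- The divergence of `h` at `x` for the Chern connection of `g`. -/
def divChern (g : BilinField E M) (h : EndField E M) (x : M) : TangentSpace 𝓘(ℝ, E) x →L[ℝ] ℝ :=
  divLoc (V := E) (chernConn cplxStr (chartMetric g x)) (chartEnd h x) (extChartAt 𝓘(ℝ, E) x x)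

/-- The first Chern-Ricci symmetric endomorphism of `g` at `x`. -/
def chernRicci (g : BilinField E M) (x : M) :
    TangentSpace 𝓘(ℝ, E) x →L[ℝ] TangentSpace 𝓘(ℝ, E) x :=
  chernRicciLoc (V := E) cplxStr (chartMetric g x) (extChartAt 𝓘(ℝ, E) x x)

/-- The Riemannian Ricci endomorphism of `g` at `x`. -/
def ricci (g : BilinField E M) (x : M) :
    TangentSpace 𝓘(ℝ, E) x →L[ℝ] TangentSpace 𝓘(ℝ, E) x :=
  ricciLoc (V := E) (chartMetric g x) (extChartAt 𝓘(ℝ, E) x x)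

/-- The Chern-scalar curvature of `g` at `x`. -/
def chernScal (g : BilinField E M) (x : M) : ℝ :=
  chernScalLoc (V := E) cplxStr (chartMetric g x) (extChartAt 𝓘(ℝ, E) x x)

/-- The differential at `g` in the direction of `h` of the Chern-scalar curvature. -/
def chernScalVar (g : BilinField E M) (h : EndField E M) (x : M) : ℝ :=
  deriv (fun s : ℝ => chernScal (vary g h s) x) 0

end Manifold

end ChernVariation

end

noncomputable section

namespace ChernVariation

/-! ### Linear algebra of a scalar product with an orthogonal complex structure. -/

section LinearAlgebra

variable {V : Type*} [NormedAddCommGroup V] [NormedSpace ℝ V]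
  {B : V →L[ℝ] V →L[ℝ] ℝ} {J : V →L[ℝ] V}

/-! In a holomorphic chart `J` is constant and the Chern connection has the complex bilinear
Christoffel symbol `½(G⁻¹ D_X G - J G⁻¹ D_{JX} G)`. Traces of its curvature, plain or against `J`,
therefore involve only `τ = d log det G` (`metricTrForm`). With `Q = Dτ`, the coordinate Hessian of
`log det G`, the Chern-scalar curvature is `-½ tr(G⁻¹ Q)` (`chernScalLoc_eq`).

Moving the metric along `G(Id + sH)` changes `log det G` at the rate `tr H`, a function that does
not involve `G`, even when `H` is not symmetric and the form has to be symmetrized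
(`trR_raise_symPart`). Since parameter and space derivatives commute, `Q` varies by the coordinate
Hessian of `tr H` (`hasDerivAt_fderiv_metricTrForm`). Differentiating twice gives a sum of three
traces in the chart: `H₁ H₂` against `G⁻¹Q`, and each `Hᵢ` against the coordinate Hessian of the
complex trace of the other (`hasDerivAt_deriv_chernScalLoc`).

It remains to recognize these traces. An endomorphism commuting with `J` only pairs with the
`J`-commuting part of another one (`trR_comp_J_conj`); this produces `S(g)` and `dd^c`. The
Riemannian Hessian differs from the coordinate Hessian by Christoffel terms. Their Chern part is
invisible to such a pairing, and the part from `C = D - ∇` is cancelled by the divergence and Lee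
terms (`hess_add_div_sub_lee`). In the Kähler case `C = 0`, and the Bianchi identity expresses the
`J`-invariant part of the Ricci form through `Q` (`ricciForm_add_J`). -/

theorem apply_sharp (hB : B.IsInvertible) (α : V →L[ℝ] ℝ) : B (sharp B α) = α :=
  hB.self_apply_inverse α

theorem sharp_apply (hB : B.IsInvertible) (v : V) : sharp B (B v) = v :=
  hB.inverse_apply_self v

theorem sharp_comp_self (hB : B.IsInvertible) : sharp B ∘L B = .id ℝ V := hB.inverse_comp_self

theorem self_comp_sharp (hB : B.IsInvertible) : B ∘L sharp B = .id ℝ _ := hB.self_comp_inverse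

theorem eq_sharp_of (hB : B.IsInvertible) {v : V} {α : V →L[ℝ] ℝ} (h : ∀ w, B v w = α w) :
    v = sharp B α := by
  rw [← sharp_apply hB v]
  congr 1
  ext w
  exact h w

theorem raise_apply (B b : V →L[ℝ] V →L[ℝ] ℝ) (v : V) : raise B b v = sharp B (b v) := rfl

theorem apply_raise (hB : B.IsInvertible) (b : V →L[ℝ] V →L[ℝ] ℝ) (v w : V) :
    B (raise B b v) w = b v w := by
  rw [raise_apply, apply_sharp hB]

theorem raise_self_comp (hB : B.IsInvertible) (A : V →L[ℝ] V) : raise B (B ∘L A) = A := by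
  ext v
  exact sharp_apply hB _

theorem adj_eq_of (hB : B.IsInvertible) {A C : V →L[ℝ] V}
    (h : ∀ v w, B (C v) w = B v (A w)) : adj B A = C := by
  ext v
  exact (eq_sharp_of hB fun w => h v w).symm

theorem adj_eq_self (hB : B.IsInvertible) {A : V →L[ℝ] V}
    (h : ∀ v w, B (A v) w = B v (A w)) : adj B A = A :=
  adj_eq_of hB h

theorem adj_raise (hB : B.IsInvertible) (hs : ∀ v w, B v w = B w v)
    (b : V →L[ℝ] V →L[ℝ] ℝ) : adj B (raise B b) = raise B b.flip :=
  adj_eq_of hB fun v w => by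
    rw [apply_raise hB, hs, apply_raise hB]
    rfl

/-- `♯(α ∘ J) = -J ♯α`. -/
theorem sharp_comp_J (hB : B.IsInvertible) (hJ : ∀ v, J (J v) = -v)
    (hi : ∀ v w, B (J v) (J w) = B v w) (α : V →L[ℝ] ℝ) : sharp B (α ∘L J) = -J (sharp B α) := by
  symm
  refine eq_sharp_of hB fun w => ?_
  have h : B (J (sharp B α)) (J (J w)) = B (sharp B α) (J w) := hi _ _
  rw [hJ, map_neg, apply_sharp hB] at h
  simpa using h

theorem apply_J_left (hJ : ∀ v, J (J v) = -v) (hi : ∀ v w, B (J v) (J w) = B v w) (v w : V) :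
    B (J v) w = -B v (J w) := by
  have h := hi v (J w)
  rw [hJ, map_neg] at h
  linarith

theorem rhoInv_apply (J : V →L[ℝ] V) (B α : V →L[ℝ] V →L[ℝ] ℝ) (v : V) :
    rhoInv J B α v = sharp B (α v ∘L J) := rfl

/-- Positivity gives injectivity, and `V` and its dual have the same dimension. -/
theorem isInvertible_of_pos [FiniteDimensional ℝ V] (hp : ∀ v, v ≠ 0 → 0 < B v v) :
    B.IsInvertible := by
  have hinj : Function.Injective (B : V →ₗ[ℝ] V →L[ℝ] ℝ) := by
    rw [injective_iff_map_eq_zero]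
    intro v hv
    by_contra hne
    have h := hp v hne
    have h2 : B v = 0 := hv
    simp [h2] at h
  have hd : Module.finrank ℝ V = Module.finrank ℝ (V →L[ℝ] ℝ) := by
    rw [← LinearEquiv.finrank_eq (LinearMap.toContinuousLinearMap (𝕜 := ℝ) (E := V) (F' := ℝ))]
    exact (Subspace.dual_finrank_eq).symm
  exact ⟨(LinearEquiv.ofInjectiveOfFinrankEq _ hinj hd).toContinuousLinearEquiv, by ext; rfl⟩

variable [FiniteDimensional ℝ V]

theorem trR_comp_comm {W : Type*} [NormedAddCommGroup W] [NormedSpace ℝ W] [FiniteDimensional ℝ W]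
    (A : V →L[ℝ] W) (C : W →L[ℝ] V) : trR (A ∘L C) = trR (C ∘L A) :=
  LinearMap.trace_comp_comm' (C : W →ₗ[ℝ] V) (A : V →ₗ[ℝ] W)

theorem trR_precomp (A : V →L[ℝ] V) :
    trR (V := V →L[ℝ] ℝ) (ContinuousLinearMap.precomp ℝ A) = trR A := by
  rw [trR_apply, trR_apply, ← LinearMap.trace_transpose' (A : V →ₗ[ℝ] V),
    ← LinearMap.trace_conj' _ (LinearMap.toContinuousLinearMap (𝕜 := ℝ) (E := V) (F' := ℝ))]
  congr 1

/-- The adjoint is the transpose of `A` conjugated by `B`. -/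
theorem trR_adj (hB : B.IsInvertible) (A : V →L[ℝ] V) : trR (adj B A) = trR A := by
  rw [adj, trR_comp_comm, ContinuousLinearMap.comp_assoc, self_comp_sharp hB,
    ContinuousLinearMap.comp_id, trR_precomp]

theorem trR_raise_flip (hB : B.IsInvertible) (hs : ∀ v w, B v w = B w v)
    (b : V →L[ℝ] V →L[ℝ] ℝ) : trR (raise B b.flip) = trR (raise B b) := by
  rw [← adj_raise hB hs, trR_adj hB]

theorem trR_J_conj (hJ : ∀ v, J (J v) = -v) (A : V →L[ℝ] V) : trR (J ∘L A ∘L J) = -trR A := by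
  rw [trR_comp_comm, ContinuousLinearMap.comp_assoc,
    show J ∘L J = -.id ℝ V from by ext v; simp [hJ], ContinuousLinearMap.comp_neg, map_neg,
    ContinuousLinearMap.comp_id]

theorem trR_eq_zero_of_anticomm (hJ : ∀ v, J (J v) = -v) {A : V →L[ℝ] V}
    (h : ∀ v, A (J v) = -J (A v)) : trR A = 0 := by
  have h1 := trR_J_conj hJ A
  rw [show J ∘L A ∘L J = A from by ext v; simp [h, hJ]] at h1
  linarith

/-- A symmetric endomorphism has trace zero against a skew one. -/
theorem trR_J_comp_symm (hB : B.IsInvertible) (hJ : ∀ v, J (J v) = -v)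
    (hi : ∀ v w, B (J v) (J w) = B v w) {A : V →L[ℝ] V}
    (h : ∀ v w, B (A v) w = B v (A w)) : trR (J ∘L A) = 0 := by
  have h1 : adj B (J ∘L A) = -(A ∘L J) := adj_eq_of hB fun v w => by
    simp [h, apply_J_left hJ hi]
  have h2 := trR_adj hB (J ∘L A)
  rw [h1, map_neg, trR_comp_comm] at h2
  linarith

theorem trR_eq_zero_of_skew (hB : B.IsInvertible) {A : V →L[ℝ] V}
    (h : ∀ v w, B (A v) w = -B v (A w)) : trR A = 0 := by
  have h1 : adj B A = -A := adj_eq_of hB fun v w => by simp [h]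
  have h2 := trR_adj hB A
  rw [h1, map_neg] at h2
  linarith

theorem trC_apply (A : V →L[ℝ] V) : trC A = 1 / 2 * trR A := rfl

end LinearAlgebra

/-! ### Differentiating the inverse metric and `log det G`. -/

section Calculus

variable {V W : Type*} [NormedAddCommGroup V] [NormedSpace ℝ V]
  [NormedAddCommGroup W] [NormedSpace ℝ W]

theorem fderiv_clm_apply_two {F : Type*} [NormedAddCommGroup F] [NormedSpace ℝ F]
    {b : W → V →L[ℝ] V →L[ℝ] F} {w : W} (hb : DifferentiableAt ℝ b w)
    (X : W) (Y Z : V) : fderiv ℝ (fun y => b y Y Z) w X = fderiv ℝ b w X Y Z := by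
  have h := (hb.hasFDerivAt.clm_apply (hasFDerivAt_const Y w)).clm_apply (hasFDerivAt_const Z w)
  rw [h.fderiv]
  simp

theorem fderiv_clm_apply_one {F : Type*} [NormedAddCommGroup F] [NormedSpace ℝ F]
    {b : W → V →L[ℝ] F} {w : W} (hb : DifferentiableAt ℝ b w)
    (X : W) (Y : V) : fderiv ℝ (fun y => b y Y) w X = fderiv ℝ b w X Y := by
  have h := hb.hasFDerivAt.clm_apply (hasFDerivAt_const Y w)
  rw [h.fderiv]
  simp

variable [FiniteDimensional ℝ V]

theorem contDiffAt_sharp {G : W → V →L[ℝ] V →L[ℝ] ℝ} {w : W} {n : WithTop ℕ∞}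
    (hG : ContDiffAt ℝ n G w) (hi : (G w).IsInvertible) :
    ContDiffAt ℝ n (fun y => sharp (G y)) w := by
  have : CompleteSpace V := FiniteDimensional.complete ℝ V
  exact (hi.contDiffAt_map_inverse (n := n)).comp w hG

theorem eventually_isInvertible {W : Type*} [TopologicalSpace W]
    {G : W → V →L[ℝ] V →L[ℝ] ℝ} {w : W}
    (hG : ContinuousAt G w) (hi : (G w).IsInvertible) :
    ∀ᶠ y in 𝓝 w, (G y).IsInvertible := by
  have : CompleteSpace V := FiniteDimensional.complete ℝ V
  obtain ⟨e, he⟩ := hi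
  have h := ContinuousLinearEquiv.nhds (𝕜 := ℝ) e
  rw [he] at h
  exact hG h

/-- Comes from differentiating `sharp (G y) ∘L G y = id`, which holds near `w` because invertibility
is an open condition. The source `W` is arbitrary so that both the space variable and the parameter
are covered. -/
theorem fderiv_sharp {G : W → V →L[ℝ] V →L[ℝ] ℝ} {w : W} (hG : ContDiffAt ℝ 1 G w)
    (hi : (G w).IsInvertible) (X : W) :
    fderiv ℝ (fun y => sharp (G y)) w X =
      -(sharp (G w) ∘L fderiv ℝ G w X ∘L sharp (G w)) := by
  have hS : DifferentiableAt ℝ (fun y => sharp (G y)) w :=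
    (contDiffAt_sharp hG hi).differentiableAt (by norm_num)
  have hD : DifferentiableAt ℝ G w := hG.differentiableAt (by norm_num)
  have h1 := hS.hasFDerivAt.clm_comp hD.hasFDerivAt
  have h2 : (fun y => sharp (G y) ∘L G y) =ᶠ[𝓝 w] fun _ => ContinuousLinearMap.id ℝ V := by
    filter_upwards [eventually_isInvertible hG.continuousAt hi] with y hy
    exact sharp_comp_self hy
  have h3 := h1.unique ((hasFDerivAt_const (ContinuousLinearMap.id ℝ V) w).congr_of_eventuallyEq h2)
  ext α
  have h4 := congrArg (fun T => T X (sharp (G w) α)) h3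
  simp only [add_apply, ContinuousLinearMap.comp_apply,
    ContinuousLinearMap.compL_apply, ContinuousLinearMap.flip_apply, zero_apply,
    apply_sharp hi] at h4
  simp only [neg_apply, ContinuousLinearMap.comp_apply]
  rw [eq_neg_iff_add_eq_zero, add_comm]
  exact h4

/-- The derivative of the trace of a bilinear form with respect to a varying metric. -/
theorem fderiv_trR_raise {G b : W → V →L[ℝ] V →L[ℝ] ℝ} {w : W} (hG : ContDiffAt ℝ 1 G w)
    (hi : (G w).IsInvertible) (hb : DifferentiableAt ℝ b w) (X : W) :
    fderiv ℝ (fun y => trR (raise (G y) (b y))) w X =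
      trR (raise (G w) (fderiv ℝ b w X))
        - trR (raise (G w) (fderiv ℝ G w X) ∘L raise (G w) (b w)) := by
  have hS : DifferentiableAt ℝ (fun y => sharp (G y)) w :=
    (contDiffAt_sharp hG hi).differentiableAt (by norm_num)
  have h1 := (trR (V := V)).hasFDerivAt.comp w (hS.hasFDerivAt.clm_comp hb.hasFDerivAt)
  rw [show (fun y => trR (raise (G y) (b y))) = trR ∘ fun y => sharp (G y) ∘L b y from rfl,
    h1.fderiv]
  simp only [add_apply, ContinuousLinearMap.comp_apply,
    ContinuousLinearMap.compL_apply, ContinuousLinearMap.flip_apply, fderiv_sharp hG hi, map_add,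
    map_neg, sub_eq_add_neg]
  rfl

/-- The trace of `D G` with respect to `G`: the differential of `log det G`. -/
def metricTrForm (G : V → V →L[ℝ] V →L[ℝ] ℝ) (z : V) : V →L[ℝ] ℝ :=
  trR ∘L (ContinuousLinearMap.compL ℝ V (V →L[ℝ] ℝ) V (sharp (G z))) ∘L fderiv ℝ G z

theorem metricTrForm_apply (G : V → V →L[ℝ] V →L[ℝ] ℝ) (z X : V) :
    metricTrForm G z X = trR (raise (G z) (fderiv ℝ G z X)) := rfl

theorem contDiffAt_metricTrForm {G : V → V →L[ℝ] V →L[ℝ] ℝ} {z : V} {n m : WithTop ℕ∞}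
    (hG : ContDiffAt ℝ n G z) (hi : (G z).IsInvertible) (hmn : m + 1 ≤ n) :
    ContDiffAt ℝ m (metricTrForm G) z := by
  have h1 : ContDiffAt ℝ m (fderiv ℝ G) z := hG.fderiv_right hmn
  have h2 : ContDiffAt ℝ m (fun y => sharp (G y)) z :=
    contDiffAt_sharp (hG.of_le (le_self_add.trans hmn)) hi
  exact contDiffAt_const.clm_comp
    (((ContinuousLinearMap.compL ℝ V (V →L[ℝ] ℝ) V).contDiff.contDiffAt.comp z h2).clm_comp h1)

/-- `log det G` has symmetric second derivative. -/
theorem fderiv_metricTrForm_symm {G : V → V →L[ℝ] V →L[ℝ] ℝ} {z : V}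
    (hG : ContDiffAt ℝ 2 G z) (hi : (G z).IsInvertible) (X Y : V) :
    fderiv ℝ (metricTrForm G) z X Y = fderiv ℝ (metricTrForm G) z Y X := by
  have hD : DifferentiableAt ℝ (metricTrForm G) z :=
    (contDiffAt_metricTrForm hG hi (m := 1) (by norm_num)).differentiableAt (by norm_num)
  have hG1 : ContDiffAt ℝ 1 G z := hG.of_le (by norm_num)
  have hD1 : DifferentiableAt ℝ (fderiv ℝ G) z :=
    (hG.fderiv_right (m := 1) (by norm_num)).differentiableAt (by norm_num)
  -- The first term is symmetric since second derivatives of `G` commute, the second by cyclicity of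
  -- the trace; no determinant is needed.
  have key : ∀ X Y, fderiv ℝ (metricTrForm G) z X Y =
      trR (raise (G z) (fderiv ℝ (fderiv ℝ G) z X Y))
        - trR (raise (G z) (fderiv ℝ G z X) ∘L raise (G z) (fderiv ℝ G z Y)) := by
    intro X Y
    rw [← fderiv_clm_apply_one hD]
    simp only [metricTrForm_apply]
    rw [fderiv_trR_raise hG1 hi (hD1.clm_apply (differentiableAt_const Y)),
      fderiv_clm_apply_one hD1]
  have hsymm : IsSymmSndFDerivAt ℝ G z := hG.isSymmSndFDerivAt (by simp)
  rw [key, key, hsymm.eq, trR_comp_comm]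

end Calculus

/-! ### The Chern connection and its Ricci form in a holomorphic chart. -/

section JMetric

variable {V : Type*} [NormedAddCommGroup V] [NormedSpace ℝ V]

/-- Near `z`, `G` is a nondegenerate symmetric `J`-invariant form of class `C^3`. -/
structure IsJMetricAt (J : V →L[ℝ] V) (G : V → V →L[ℝ] V →L[ℝ] ℝ) (z : V) : Prop where
  symm : ∀ᶠ y in 𝓝 z, ∀ v w, G y v w = G y w v
  inv : ∀ᶠ y in 𝓝 z, ∀ v w, G y (J v) (J w) = G y v w
  smooth : ContDiffAt ℝ 3 G z
  isInvertible : (G z).IsInvertible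

variable {J : V →L[ℝ] V} {G : V → V →L[ℝ] V →L[ℝ] ℝ} {z : V}

namespace IsJMetricAt

theorem symm_self (hG : IsJMetricAt J G z) (v w : V) : G z v w = G z w v :=
  hG.symm.self_of_nhds v w

theorem inv_self (hG : IsJMetricAt J G z) (v w : V) : G z (J v) (J w) = G z v w :=
  hG.inv.self_of_nhds v w

theorem differentiableAt (hG : IsJMetricAt J G z) : DifferentiableAt ℝ G z :=
  hG.smooth.differentiableAt (by norm_num)

theorem fderiv_symm (hG : IsJMetricAt J G z) (X v w : V) :
    fderiv ℝ G z X v w = fderiv ℝ G z X w v := by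
  rw [← fderiv_clm_apply_two hG.differentiableAt, ← fderiv_clm_apply_two hG.differentiableAt]
  rw [Filter.EventuallyEq.fderiv_eq (hG.symm.mono fun y hy => hy v w)]

theorem fderiv_inv (hG : IsJMetricAt J G z) (X v w : V) :
    fderiv ℝ G z X (J v) (J w) = fderiv ℝ G z X v w := by
  rw [← fderiv_clm_apply_two hG.differentiableAt, ← fderiv_clm_apply_two hG.differentiableAt]
  rw [Filter.EventuallyEq.fderiv_eq (hG.inv.mono fun y hy => hy v w)]

/-- As `J` is constant, `dω(JX, Y, Z) = D_{JX}G(JY, Z) + D_Y G(X, Z) - D_Z G(X, Y)`. Its last two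
terms cancel those of the Koszul formula. -/
theorem chernForm_eq (hJ : ∀ v, J (J v) = -v) (hG : IsJMetricAt J G z) (X Y Z : V) :
    chernForm J G z X Y Z =
      1 / 2 * (fderiv ℝ G z X Y Z - fderiv ℝ G z (J X) (J Y) Z) := by
  have hw : ∀ X Y Z, fderiv ℝ (fundFormLoc J G) z X Y Z = fderiv ℝ G z X (J Y) Z := by
    intro X Y Z
    have h := hG.differentiableAt.hasFDerivAt.clm_comp
      (hasFDerivAt_const (J ∘L ContinuousLinearMap.id ℝ V) z)
    have h2 : fderiv ℝ (fundFormLoc J G) z = _ := h.fderiv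
    rw [h2]
    simp
  have h : chernForm J G z X Y Z =
    leviCivitaForm G z X Y Z - 1 / 2 * dTwo (fundFormLoc J G) z (J X) Y Z := rfl
  rw [h, leviCivitaForm_apply, dTwo_apply, hw, hw, hw, hJ, map_neg, map_neg]
  simp only [neg_apply]
  ring

theorem raise_fderiv_symm (hG : IsJMetricAt J G z) (X v w : V) :
    G z (raise (G z) (fderiv ℝ G z X) v) w = G z v (raise (G z) (fderiv ℝ G z X) w) := by
  rw [apply_raise hG.isInvertible, hG.symm_self, apply_raise hG.isInvertible, hG.fderiv_symm]

theorem raise_fderiv_J (hJ : ∀ v, J (J v) = -v) (hG : IsJMetricAt J G z) (X v : V) :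
    raise (G z) (fderiv ℝ G z X) (J v) = J (raise (G z) (fderiv ℝ G z X) v) := by
  have h : fderiv ℝ G z X (J v) = -(fderiv ℝ G z X v ∘L J) := by
    ext w
    have h2 := hG.fderiv_inv X v (J w)
    rw [hJ, map_neg] at h2
    simp only [neg_apply, ContinuousLinearMap.comp_apply]
    linarith
  rw [raise_apply, h, map_neg, sharp_comp_J hG.isInvertible hJ hG.inv_self, neg_neg, raise_apply]

theorem chernConn_apply (hJ : ∀ v, J (J v) = -v) (hG : IsJMetricAt J G z) (X Y : V) :
    chernConn J G z X Y = (1 / 2 : ℝ) • (raise (G z) (fderiv ℝ G z X) Y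
      - J (raise (G z) (fderiv ℝ G z (J X)) Y)) := by
  rw [← raise_fderiv_J hJ hG, chernConn, raiseLast_apply, raise_apply, raise_apply, ← map_sub,
    ← map_smul]
  congr 1
  ext Z
  simp [chernForm_eq hJ hG]

theorem chernConn_J_right (hJ : ∀ v, J (J v) = -v) (hG : IsJMetricAt J G z) (X Y : V) :
    chernConn J G z X (J Y) = J (chernConn J G z X Y) := by
  simp only [chernConn_apply hJ hG, raise_fderiv_J hJ hG, map_smul, map_sub]

/-- Together with `chernConn_J_right`, this says that the Christoffel symbol is complex bilinear,
which is special to holomorphic coordinates. -/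
theorem chernConn_J_left (hJ : ∀ v, J (J v) = -v) (hG : IsJMetricAt J G z) (X Y : V) :
    chernConn J G z (J X) Y = J (chernConn J G z X Y) := by
  simp only [chernConn_apply hJ hG, hJ, map_smul, map_sub, raise_apply, map_neg, neg_apply]
  abel_nf

theorem contDiffAt_leviCivitaForm (hG : IsJMetricAt J G z) :
    ContDiffAt ℝ 2 (leviCivitaForm G) z := by
  have h1 : ContDiffAt ℝ 2 (fderiv ℝ G) z := hG.smooth.fderiv_right (by norm_num)
  have h2 : ContDiffAt ℝ 2 (fun y => (fderiv ℝ G y).flip) z :=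
    (ContinuousLinearMap.flipₗᵢ ℝ V V (V →L[ℝ] ℝ)).toContinuousLinearEquiv.contDiff.contDiffAt.comp
      z h1
  exact (h1.add h2 |>.sub (contDiffAt_const.clm_comp h2)).const_smul _

variable [FiniteDimensional ℝ V]

theorem eventually (hG : IsJMetricAt J G z) : ∀ᶠ y in 𝓝 z, IsJMetricAt J G y := by
  filter_upwards [eventually_eventually_nhds.2 hG.symm, eventually_eventually_nhds.2 hG.inv,
    hG.smooth.eventually (by simp),
    eventually_isInvertible hG.smooth.continuousAt hG.isInvertible] with y h1 h2 h3 h4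
  exact ⟨h1, h2, h3, h4⟩

theorem contDiffAt_raiseLast {T : V → V →L[ℝ] V →L[ℝ] V →L[ℝ] ℝ} (hG : IsJMetricAt J G z)
    (hT : ContDiffAt ℝ 2 T z) : ContDiffAt ℝ 2 (fun y => raiseLast (G y) (T y)) z := by
  have h2 : ContDiffAt ℝ 2 (fun y => sharp (G y)) z :=
    contDiffAt_sharp (hG.smooth.of_le (by norm_num)) hG.isInvertible
  exact ((ContinuousLinearMap.compL ℝ V (V →L[ℝ] ℝ) V).contDiff.contDiffAt.comp z h2).clm_comp hT

theorem contDiffAt_chernConn (hG : IsJMetricAt J G z) : ContDiffAt ℝ 2 (chernConn J G) z := by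
  refine hG.contDiffAt_raiseLast ?_
  have h0 : ContDiffAt ℝ 3 (fundFormLoc J G) z := hG.smooth.clm_comp contDiffAt_const
  have h1 : ContDiffAt ℝ 2 (fderiv ℝ (fundFormLoc J G)) z := h0.fderiv_right (by norm_num)
  have h2 : ContDiffAt ℝ 2 (fun y => (fderiv ℝ (fundFormLoc J G) y).flip) z :=
    (ContinuousLinearMap.flipₗᵢ ℝ V V (V →L[ℝ] ℝ)).toContinuousLinearEquiv.contDiff.contDiffAt.comp
      z h1
  have h3 : ContDiffAt ℝ 2 (dTwo (fundFormLoc J G)) z :=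
    h1.sub h2 |>.add (contDiffAt_const.clm_comp h2)
  exact hG.contDiffAt_leviCivitaForm.sub ((h3.clm_comp contDiffAt_const).const_smul _)

/-- Only the first half of the Christoffel symbol contributes: the other is `J` composed with a
symmetric endomorphism, hence trace-free. -/
theorem trR_chernConn (hJ : ∀ v, J (J v) = -v) (hG : IsJMetricAt J G z) (X : V) :
    trR (chernConn J G z X) = 1 / 2 * metricTrForm G z X := by
  have h : chernConn J G z X = (1 / 2 : ℝ) • (raise (G z) (fderiv ℝ G z X)
      - J ∘L raise (G z) (fderiv ℝ G z (J X))) := by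
    ext Y; exact chernConn_apply hJ hG X Y
  rw [h, map_smul, map_sub, trR_J_comp_symm hG.isInvertible hJ hG.inv_self
    (hG.raise_fderiv_symm _), sub_zero, metricTrForm_apply, smul_eq_mul]

theorem trR_J_chernConn (hJ : ∀ v, J (J v) = -v) (hG : IsJMetricAt J G z) (X : V) :
    trR (J ∘L chernConn J G z X) = 1 / 2 * metricTrForm G z (J X) := by
  rw [← trR_chernConn hJ hG]
  congr 1
  ext Y
  exact (chernConn_J_left hJ hG X Y).symm

theorem differentiableAt_metricTrForm (hG : IsJMetricAt J G z) :
    DifferentiableAt ℝ (metricTrForm G) z :=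
  (contDiffAt_metricTrForm hG.smooth hG.isInvertible (m := 1) (by norm_num)).differentiableAt
    (by norm_num)

theorem fderiv_metricTrForm_symm (hG : IsJMetricAt J G z) (X Y : V) :
    fderiv ℝ (metricTrForm G) z X Y = fderiv ℝ (metricTrForm G) z Y X :=
  ChernVariation.fderiv_metricTrForm_symm (hG.smooth.of_le (by norm_num)) hG.isInvertible X Y

end IsJMetricAt

theorem curv_apply (Γ : V → V →L[ℝ] V →L[ℝ] V) (z X Y : V) :
    curv Γ z X Y = fderiv ℝ Γ z X Y - fderiv ℝ Γ z Y X + (Γ z X ∘L Γ z Y - Γ z Y ∘L Γ z X) := by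
  ext W
  change secondDer Γ z X Y W - secondDer Γ z Y X W = _
  simp only [secondDer_apply, add_apply, sub_apply, ContinuousLinearMap.comp_apply]
  abel

namespace IsJMetricAt
variable [FiniteDimensional ℝ V]

theorem fderiv_trR_comp_chernConn (hG : IsJMetricAt J G z) (A : V →L[ℝ] V) (X Y : V) :
    trR (A ∘L fderiv ℝ (chernConn J G) z X Y) =
      fderiv ℝ (fun y => trR (A ∘L chernConn J G y Y)) z X := by
  have hD : DifferentiableAt ℝ (chernConn J G) z :=
    hG.contDiffAt_chernConn.differentiableAt (by norm_num)
  have h := ((trR (V := V) ∘L ContinuousLinearMap.compL ℝ V V V A).hasFDerivAt).comp z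
    (hD.hasFDerivAt.clm_apply (hasFDerivAt_const Y z))
  have h2 := congrArg (fun T => T X) h.fderiv
  simp only [ContinuousLinearMap.comp_apply, add_apply, ContinuousLinearMap.flip_apply,
    zero_apply, map_zero, zero_add] at h2
  exact h2.symm

/-- The connection trace is the closed form `½τ`, and the quadratic part of the curvature is a
commutator. -/
theorem trR_curv_chernConn (hJ : ∀ v, J (J v) = -v) (hG : IsJMetricAt J G z) (X Y : V) :
    trR (curv (chernConn J G) z X Y) = 0 := by
  have h : ∀ X Y, trR (fderiv ℝ (chernConn J G) z X Y) =
      1 / 2 * fderiv ℝ (metricTrForm G) z X Y := by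
    intro X Y
    have h := hG.fderiv_trR_comp_chernConn (.id ℝ V) X Y
    rw [ContinuousLinearMap.id_comp] at h
    rw [h, Filter.EventuallyEq.fderiv_eq (f := fun y => (1 / 2 : ℝ) * metricTrForm G y Y),
      fderiv_const_mul (hG.differentiableAt_metricTrForm.clm_apply (differentiableAt_const Y)),
      smul_apply, fderiv_clm_apply_one hG.differentiableAt_metricTrForm, smul_eq_mul]
    filter_upwards [hG.eventually] with y hy
    rw [ContinuousLinearMap.id_comp, hy.trR_chernConn hJ]
  rw [curv_apply, map_add, map_sub, map_sub, h, h, hG.fderiv_metricTrForm_symm X Y,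
    trR_comp_comm (chernConn J G z X)]
  ring

/-- The quadratic part still drops out, because `J` commutes with every `chernConn J G z X`; what
remains is the exterior derivative of `½ τ ∘ J`. -/
theorem trR_J_curv_chernConn (hJ : ∀ v, J (J v) = -v) (hG : IsJMetricAt J G z) (X Y : V) :
    trR (J ∘L curv (chernConn J G) z X Y) = 1 / 2 *
      (fderiv ℝ (metricTrForm G) z X (J Y) - fderiv ℝ (metricTrForm G) z Y (J X)) := by
  have h : ∀ X Y, trR (J ∘L fderiv ℝ (chernConn J G) z X Y) =
      1 / 2 * fderiv ℝ (metricTrForm G) z X (J Y) := by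
    intro X Y
    rw [hG.fderiv_trR_comp_chernConn J X Y,
      Filter.EventuallyEq.fderiv_eq (f := fun y => (1 / 2 : ℝ) * metricTrForm G y (J Y)),
      fderiv_const_mul (hG.differentiableAt_metricTrForm.clm_apply (differentiableAt_const _)),
      smul_apply, fderiv_clm_apply_one hG.differentiableAt_metricTrForm, smul_eq_mul]
    filter_upwards [hG.eventually] with y hy
    rw [hy.trR_J_chernConn hJ]
  have h2 : J ∘L (chernConn J G z Y ∘L chernConn J G z X) =
      chernConn J G z Y ∘L (J ∘L chernConn J G z X) := by
    ext W; simp [hG.chernConn_J_right hJ]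
  have h3 : trR (J ∘L (chernConn J G z X ∘L chernConn J G z Y)) =
      trR (J ∘L (chernConn J G z Y ∘L chernConn J G z X)) := by
    rw [h2, trR_comp_comm (chernConn J G z Y), ContinuousLinearMap.comp_assoc]
  rw [curv_apply, ContinuousLinearMap.comp_add, ContinuousLinearMap.comp_sub,
    ContinuousLinearMap.comp_sub, map_add, map_sub, map_sub, h, h, h3]
  ring

theorem chernRicciForm_eq (hJ : ∀ v, J (J v) = -v) (hG : IsJMetricAt J G z) (X Y : V) :
    chernRicciForm J G z X Y = 1 / 4 *
      (fderiv ℝ (metricTrForm G) z X (J Y) - fderiv ℝ (metricTrForm G) z Y (J X)) := by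
  have h : J ∘L chernCurv J G z X Y = -(J ∘L curv (chernConn J G) z X Y) := by
    ext W
    simp [chernCurv]
  rw [chernRicciForm_apply, h, map_neg, trC_apply, trR_J_curv_chernConn hJ hG]
  ring

/-- `S = -¼ (Q - J Q J)` where `Q` is the Hessian of `log det G` in the chart. -/
theorem chernRicciLoc_eq (hJ : ∀ v, J (J v) = -v) (hG : IsJMetricAt J G z) :
    chernRicciLoc J G z = -(1 / 4 : ℝ) • (raise (G z) (fderiv ℝ (metricTrForm G) z)
      - J ∘L raise (G z) (fderiv ℝ (metricTrForm G) z) ∘L J) := by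
  ext X
  have h := sharp_comp_J hG.isInvertible hJ hG.inv_self (fderiv ℝ (metricTrForm G) z (J X))
  rw [chernRicciLoc, rhoInv_apply]
  simp only [smul_apply, sub_apply, ContinuousLinearMap.comp_apply, raise_apply]
  rw [sub_eq_add_neg, ← h, ← map_add, ← map_smul]
  congr 1
  ext Y
  simp only [ContinuousLinearMap.comp_apply, chernRicciForm_eq hJ hG, hJ, map_neg, smul_apply,
    add_apply, smul_eq_mul]
  rw [hG.fderiv_metricTrForm_symm (J Y) (J X)]
  ring

/-- Both halves of `S` have equal trace because `tr(JQJ) = -tr Q`. -/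
theorem chernScalLoc_eq (hJ : ∀ v, J (J v) = -v) (hG : IsJMetricAt J G z) :
    chernScalLoc J G z = -(1 / 2) * trR (raise (G z) (fderiv ℝ (metricTrForm G) z)) := by
  have h : chernScalLoc J G z = 2 * trC (chernRicciLoc J G z) := rfl
  rw [h, chernRicciLoc_eq hJ hG, trC_apply, map_smul, map_sub, trR_J_conj hJ, smul_eq_mul]
  ring

end IsJMetricAt

end JMetric

/-! ### First variation along a one-parameter family of metrics. -/

section Variation

variable {V : Type*} [NormedAddCommGroup V] [NormedSpace ℝ V]
  {F : Type*} [NormedAddCommGroup F] [NormedSpace ℝ F]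

theorem fderiv_uncurry_right {f : ℝ → V → F} {s : ℝ} {z : V}
    (hf : DifferentiableAt ℝ (Function.uncurry f) (s, z)) :
    fderiv ℝ (f s) z = fderiv ℝ (Function.uncurry f) (s, z) ∘L ContinuousLinearMap.inr ℝ ℝ V :=
  (hf.hasFDerivAt.comp z (hasFDerivAt_prodMk_right s z)).fderiv

theorem deriv_uncurry_left {f : ℝ → V → F} {s : ℝ} {z : V}
    (hf : DifferentiableAt ℝ (Function.uncurry f) (s, z)) :
    deriv (fun r => f r z) s = fderiv ℝ (Function.uncurry f) (s, z) (1, 0) := by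
  have h : HasDerivAt (fun r => f r z) (fderiv ℝ (Function.uncurry f) (s, z) (1, 0)) s :=
    (hf.hasFDerivAt.comp (f := fun r => (r, z)) s
      (hasFDerivAt_prodMk_left s z)).hasDerivAt.congr_deriv (by simp)
  exact h.deriv

theorem contDiffAt_uncurry_fderiv {f : ℝ → V → F} {s : ℝ} {z : V} {n m : ℕ}
    (hf : ContDiffAt ℝ n (Function.uncurry f) (s, z)) (hmn : m + 1 ≤ n) :
    ContDiffAt ℝ m (Function.uncurry fun r => fderiv ℝ (f r)) (s, z) := by
  have h1 : ContDiffAt ℝ m (fderiv ℝ (Function.uncurry f)) (s, z) :=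
    hf.fderiv_right (by exact_mod_cast hmn)
  refine (h1.clm_comp (contDiffAt_const (c := ContinuousLinearMap.inr ℝ ℝ V))).congr_of_eventuallyEq
    ?_
  filter_upwards [hf.eventually (by simp)] with p hp
  exact fderiv_uncurry_right (hp.differentiableAt (by norm_cast; omega))

/-- Derivatives in a parameter and in the space variable commute. -/
theorem hasDerivAt_fderiv_param {f : ℝ → V → F} {s : ℝ} {z : V}
    (hf : ContDiffAt ℝ 2 (Function.uncurry f) (s, z)) :
    HasDerivAt (fun r => fderiv ℝ (f r) z) (fderiv ℝ (fun y => deriv (fun r => f r y) s) z) s := by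
  set D := fderiv ℝ (Function.uncurry f) with hDdef
  have hD : HasFDerivAt D (fderiv ℝ D (s, z)) (s, z) :=
    ((hf.fderiv_right (m := 1) (by norm_num)).differentiableAt (by norm_num)).hasFDerivAt
  have hev : ∀ᶠ p in 𝓝 (s, z), DifferentiableAt ℝ (Function.uncurry f) p := by
    filter_upwards [hf.eventually (by simp)] with p hp
    exact hp.differentiableAt (by norm_num)
  have h1 : HasDerivAt (fun r => D (r, z)) (fderiv ℝ D (s, z) (1, 0)) s :=
    (hD.comp s (hasFDerivAt_prodMk_left s z)).hasDerivAt.congr_deriv (by simp)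
  have h2 := h1.clm_comp (hasDerivAt_const s (ContinuousLinearMap.inr ℝ ℝ V))
  have h3 : HasFDerivAt (fun y => D (s, y) (1, 0)) _ z :=
    (hD.comp z (hasFDerivAt_prodMk_right s z)).clm_apply (hasFDerivAt_const ((1 : ℝ), (0 : V)) z)
  have h4 : HasFDerivAt (fun y => deriv (fun r => f r y) s) _ z :=
    h3.congr_of_eventuallyEq (by
      filter_upwards [(Continuous.prodMk_right s).continuousAt.eventually hev] with y hy
      exact deriv_uncurry_left hy)
  have h5 : HasDerivAt (fun r => fderiv ℝ (f r) z) _ s :=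
    h2.congr_of_eventuallyEq (by
      filter_upwards [(Continuous.prodMk_left z).continuousAt.eventually hev] with r hr
      exact fderiv_uncurry_right hr)
  refine h5.congr_deriv ?_
  rw [h4.fderiv]
  ext v
  -- Both sides are the joint second derivative in the directions `(1, 0)` and `(0, v)`, taken in
  -- opposite orders.
  have hs : IsSymmSndFDerivAt ℝ (Function.uncurry f) (s, z) := hf.isSymmSndFDerivAt (by simp)
  simpa using (hs.eq (0, v) (1, 0)).symm

variable {G : ℝ → V → V →L[ℝ] V →L[ℝ] ℝ} {s : ℝ} {z : V}

theorem contDiffAt_param {n : WithTop ℕ∞} {f : ℝ → V → F}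
    (hf : ContDiffAt ℝ n (Function.uncurry f) (s, z)) : ContDiffAt ℝ n (fun r => f r z) s :=
  hf.comp s (f := fun r : ℝ => (r, z)) (contDiffAt_id.prodMk contDiffAt_const)

theorem contDiffAt_space {n : WithTop ℕ∞} {f : ℝ → V → F}
    (hf : ContDiffAt ℝ n (Function.uncurry f) (s, z)) : ContDiffAt ℝ n (f s) z :=
  hf.comp z (f := fun y : V => (s, y)) (contDiffAt_const.prodMk contDiffAt_id)

variable [FiniteDimensional ℝ V]

theorem hasDerivAt_raise {B b : ℝ → V →L[ℝ] V →L[ℝ] ℝ} {s : ℝ} {b' : V →L[ℝ] V →L[ℝ] ℝ}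
    (hB : ContDiffAt ℝ 1 B s) (hi : (B s).IsInvertible) (hb : HasDerivAt b b' s) :
    HasDerivAt (fun r => raise (B r) (b r))
      (raise (B s) b' - raise (B s) (deriv B s) ∘L raise (B s) (b s)) s := by
  have hS : DifferentiableAt ℝ (fun y => sharp (B y)) s :=
    (contDiffAt_sharp hB hi).differentiableAt (by norm_num)
  refine (hS.hasDerivAt.clm_comp hb).congr_deriv ?_
  rw [← fderiv_apply_one_eq_deriv, fderiv_sharp hB hi, fderiv_apply_one_eq_deriv]
  simp only [raise, ContinuousLinearMap.neg_comp, ContinuousLinearMap.comp_assoc]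
  abel

theorem contDiffAt_uncurry_metricTrForm (hG : ContDiffAt ℝ 3 (Function.uncurry G) (s, z))
    (hi : (G s z).IsInvertible) :
    ContDiffAt ℝ 2 (Function.uncurry fun r => metricTrForm (G r)) (s, z) := by
  have h1 : ContDiffAt ℝ 2 (Function.uncurry fun r => fderiv ℝ (G r)) (s, z) :=
    contDiffAt_uncurry_fderiv (n := 3) (m := 2) hG (by norm_num)
  have h2 : ContDiffAt ℝ 2 (fun p => sharp (Function.uncurry G p)) (s, z) :=
    contDiffAt_sharp (hG.of_le (by norm_num)) hi
  exact contDiffAt_const.clm_comp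
    (((ContinuousLinearMap.compL ℝ V (V →L[ℝ] ℝ) V).contDiff.contDiffAt.comp (s, z) h2).clm_comp h1)

/-- The variation of `d log det G` is the differential of the variation of `log det G`. -/
theorem deriv_metricTrForm (hG : ContDiffAt ℝ 3 (Function.uncurry G) (s, z))
    (hi : (G s z).IsInvertible) :
    deriv (fun r => metricTrForm (G r) z) s =
      fderiv ℝ (fun y => trR (raise (G s y) (deriv (fun r => G r y) s))) z := by
  have hG2 : ContDiffAt ℝ 2 (Function.uncurry G) (s, z) := hG.of_le (by norm_num)
  have hG1 : ContDiffAt ℝ 1 (Function.uncurry G) (s, z) := hG.of_le (by norm_num)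
  have hswap := hasDerivAt_fderiv_param hG2
  have hda : DifferentiableAt ℝ (fun r => metricTrForm (G r) z) s :=
    (contDiffAt_param (contDiffAt_uncurry_metricTrForm hG hi)).differentiableAt (by norm_num)
  have hd' : DifferentiableAt ℝ (fun y => deriv (fun r => G r y) s) z := by
    have h1 : ContDiffAt ℝ 1 (fderiv ℝ (Function.uncurry G)) (s, z) :=
      hG2.fderiv_right (by norm_num)
    have h2 : DifferentiableAt ℝ (fun y => fderiv ℝ (Function.uncurry G) (s, y) (1, 0)) z :=
      (contDiffAt_space (f := fun r y => fderiv ℝ (Function.uncurry G) (r, y))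
        h1).differentiableAt (by norm_num) |>.clm_apply (differentiableAt_const _)
    refine h2.congr_of_eventuallyEq ?_
    filter_upwards [(Continuous.prodMk_right s).continuousAt.eventually
      (hG2.eventually (by simp))] with y hy
    exact deriv_uncurry_left (hy.differentiableAt (by norm_num))
  ext X
  have h1 : deriv (fun r => metricTrForm (G r) z) s X =
      deriv (fun r => trR (raise (G r z) (fderiv ℝ (G r) z X))) s := by
    have h := hda.hasDerivAt.clm_apply (hasDerivAt_const s X)
    simp only [map_zero, add_zero] at h
    exact h.deriv.symm
  have h2 : HasDerivAt (fun r => fderiv ℝ (G r) z X) _ s :=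
    hswap.clm_apply (hasDerivAt_const s X)
  -- Both derivatives expand into the trace of the mixed derivative of `G` minus a product of two
  -- raised first derivatives; the products differ only in order.
  rw [h1, fderiv_trR_raise (contDiffAt_space hG1) hi hd',
    ← fderiv_apply_one_eq_deriv, fderiv_trR_raise (contDiffAt_param hG1) hi h2.differentiableAt,
    fderiv_apply_one_eq_deriv, fderiv_apply_one_eq_deriv, h2.deriv, trR_comp_comm]
  simp

theorem hasDerivAt_fderiv_metricTrForm (hG : ContDiffAt ℝ 3 (Function.uncurry G) (s, z))
    (hi : (G s z).IsInvertible) :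
    HasDerivAt (fun r => fderiv ℝ (metricTrForm (G r)) z)
      (fderiv ℝ (fderiv ℝ (fun y => trR (raise (G s y) (deriv (fun r => G r y) s)))) z) s := by
  refine (hasDerivAt_fderiv_param (contDiffAt_uncurry_metricTrForm hG hi)).congr_deriv ?_
  refine Filter.EventuallyEq.fderiv_eq ?_
  have hc : ContinuousAt (G s) z := (contDiffAt_space hG).continuousAt
  filter_upwards [(Continuous.prodMk_right s).continuousAt.eventually
    (hG.eventually (by simp)), eventually_isInvertible hc hi] with y hy hy2
  exact deriv_metricTrForm hy hy2

/-- The first variation of the Chern-scalar curvature, in terms of the bilinear form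
`G' = dG/ds`. -/
theorem hasDerivAt_chernScalLoc {J : V →L[ℝ] V} (hJ : ∀ v, J (J v) = -v)
    (hG : ContDiffAt ℝ 3 (Function.uncurry G) (s, z))
    (hm : ∀ᶠ r in 𝓝 s, IsJMetricAt J (G r) z) :
    HasDerivAt (fun r => chernScalLoc J (G r) z)
      (1 / 2 * trR (raise (G s z) (deriv (fun r => G r z) s)
          ∘L raise (G s z) (fderiv ℝ (metricTrForm (G s)) z))
        - 1 / 2 * trR (raise (G s z)
          (fderiv ℝ (fderiv ℝ (fun y => trR (raise (G s y) (deriv (fun r => G r y) s)))) z))) s := by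
  have hi := hm.self_of_nhds.isInvertible
  have hG1 : ContDiffAt ℝ 1 (Function.uncurry G) (s, z) := hG.of_le (by norm_num)
  have h1 := hasDerivAt_raise (contDiffAt_param hG1) hi (hasDerivAt_fderiv_metricTrForm hG hi)
  have h2 := ((trR (V := V)).hasFDerivAt.comp_hasDerivAt s h1).const_mul (-(1 / 2) : ℝ)
  have h3 := h2.congr_of_eventuallyEq (f₁ := fun r => chernScalLoc J (G r) z) (by
    filter_upwards [hm] with r hr
    exact hr.chernScalLoc_eq hJ)
  refine h3.congr_deriv ?_
  rw [map_sub]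
  ring

end Variation

/-! ### Second variation as a trace formula in the chart. -/

section SecondVariation

variable {V : Type*} [NormedAddCommGroup V] [NormedSpace ℝ V]

/-- Near `z`, `H` is a `G`-symmetric endomorphism field of class `C^3` commuting with `J`. -/
structure IsSymInvariantAt (J : V →L[ℝ] V) (G : V → V →L[ℝ] V →L[ℝ] ℝ) (H : V → V →L[ℝ] V)
    (z : V) : Prop where
  symm : ∀ᶠ y in 𝓝 z, ∀ v w, G y (H y v) w = G y v (H y w)
  comm : ∀ᶠ y in 𝓝 z, ∀ v, H y (J v) = J (H y v)
  smooth : ContDiffAt ℝ 3 H z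

/-- The symmetric part of `G((Id + t H)·, ·)`. -/
def perturb (G : V → V →L[ℝ] V →L[ℝ] ℝ) (H : V → V →L[ℝ] V) (t : ℝ) (y : V) :
    V →L[ℝ] V →L[ℝ] ℝ :=
  symPart (G y ∘L (ContinuousLinearMap.id ℝ V + t • H y))

theorem symPart_apply (b : V →L[ℝ] V →L[ℝ] ℝ) (v w : V) :
    symPart b v w = 1 / 2 * (b v w + b w v) := rfl

theorem symPart_eq_self {b : V →L[ℝ] V →L[ℝ] ℝ} (hb : ∀ v w, b v w = b w v) : symPart b = b := by
  ext v w
  rw [symPart_apply, hb w v]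
  ring

theorem symPart_add (b c : V →L[ℝ] V →L[ℝ] ℝ) : symPart (b + c) = symPart b + symPart c := by
  ext v w
  simp only [symPart_apply, add_apply]
  ring

theorem symPart_smul (t : ℝ) (b : V →L[ℝ] V →L[ℝ] ℝ) : symPart (t • b) = t • symPart b := by
  ext v w
  simp only [symPart_apply, smul_apply, smul_eq_mul]
  ring

variable {J : V →L[ℝ] V} {G : V → V →L[ℝ] V →L[ℝ] ℝ} {H : V → V →L[ℝ] V} {z : V}

theorem perturb_apply (t : ℝ) (y v w : V) : perturb G H t y v w =
    1 / 2 * (G y (v + t • H y v) w + G y (w + t • H y w) v) := rfl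

theorem perturb_symm (t : ℝ) (y v w : V) : perturb G H t y v w = perturb G H t y w v := by
  rw [perturb_apply, perturb_apply, add_comm]

theorem perturb_eq {y : V} (hs : ∀ v w, G y v w = G y w v) (t : ℝ) :
    perturb G H t y = G y + t • symPart (G y ∘L H y) := by
  rw [perturb, ContinuousLinearMap.comp_add, ContinuousLinearMap.comp_id,
    ContinuousLinearMap.comp_smul, symPart_add, symPart_eq_self hs, symPart_smul]

theorem hasDerivAt_perturb {y : V} (hs : ∀ v w, G y v w = G y w v) (t : ℝ) :
    HasDerivAt (fun r => perturb G H r y) (symPart (G y ∘L H y)) t := by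
  simp only [perturb_eq hs]
  exact (((hasDerivAt_id t).smul_const _).const_add _).congr_deriv (one_smul _ _)

theorem hasDerivAt_symPart {b : ℝ → V →L[ℝ] V →L[ℝ] ℝ} {b' : V →L[ℝ] V →L[ℝ] ℝ} {s : ℝ}
    (hb : HasDerivAt b b' s) : HasDerivAt (fun r => symPart (b r)) (symPart b') s :=
  (hb.add ((ContinuousLinearMap.flipₗᵢ ℝ V V
    ℝ).toContinuousLinearEquiv.hasFDerivAt.comp_hasDerivAt s hb)).const_smul (1 / 2 : ℝ)

theorem contDiff_symPart : ContDiff ℝ ω (symPart : (V →L[ℝ] V →L[ℝ] ℝ) → V →L[ℝ] V →L[ℝ] ℝ) :=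
  (contDiff_id.add (ContinuousLinearMap.flipₗᵢ ℝ V V ℝ).toContinuousLinearEquiv.contDiff).const_smul
    (1 / 2 : ℝ)

theorem contDiffAt_uncurry_perturb (hG : ContDiffAt ℝ 3 G z) (hH : ContDiffAt ℝ 3 H z) (t : ℝ) :
    ContDiffAt ℝ 3 (Function.uncurry (perturb G H)) (t, z) := by
  have h1 : ContDiffAt ℝ 3 (fun p : ℝ × V => G p.2) (t, z) :=
    hG.comp (t, z) (f := Prod.snd) contDiffAt_snd
  have h2 : ContDiffAt ℝ 3 (fun p : ℝ × V => H p.2) (t, z) :=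
    hH.comp (t, z) (f := Prod.snd) contDiffAt_snd
  exact (contDiff_symPart.contDiffAt.of_le le_top).comp (t, z)
    (h1.clm_comp (contDiffAt_const.add (contDiffAt_fst.smul h2)))

theorem IsJMetricAt.perturb (hG : IsJMetricAt J G z) (hH : ContDiffAt ℝ 3 H z)
    (hc : ∀ᶠ y in 𝓝 z, ∀ v, H y (J v) = J (H y v)) {t : ℝ} (hi : (perturb G H t z).IsInvertible) :
    IsJMetricAt J (perturb G H t) z where
  symm := .of_forall fun y => perturb_symm t y
  inv := by
    filter_upwards [hG.inv, hc] with y h1 h2 v w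
    simp only [perturb_apply, h2, ← map_smul, ← map_add, h1]
  smooth := contDiffAt_space (contDiffAt_uncurry_perturb hG.smooth hH t)
  isInvertible := hi

theorem perturb_zero {y : V} (hs : ∀ v w, G y v w = G y w v) : perturb G H 0 y = G y := by
  rw [perturb_eq hs, zero_smul, add_zero]

theorem IsSymInvariantAt.symm_self (h : IsSymInvariantAt J G H z) (v w : V) :
    G z (H z v) w = G z v (H z w) := h.symm.self_of_nhds v w

variable [FiniteDimensional ℝ V]

theorem IsJMetricAt.eventually_perturb (hG : IsJMetricAt J G z) (hH : ContDiffAt ℝ 3 H z)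
    (hc : ∀ᶠ y in 𝓝 z, ∀ v, H y (J v) = J (H y v)) :
    ∀ᶠ t in 𝓝 (0 : ℝ), IsJMetricAt J (ChernVariation.perturb G H t) z := by
  have h1 : ContinuousAt (fun t => ChernVariation.perturb G H t z) 0 :=
    (contDiffAt_param (contDiffAt_uncurry_perturb hG.smooth hH 0)).continuousAt
  have h2 : (ChernVariation.perturb G H 0 z).IsInvertible := by
    rw [perturb_zero hG.symm_self]; exact hG.isInvertible
  filter_upwards [eventually_isInvertible h1 h2] with t ht
  exact hG.perturb hH hc ht

/-- Transposing a form does not change its trace. Hence the rate of change of `log det` is the trace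
of the direction, independently of the metric. -/
theorem trR_raise_symPart {B : V →L[ℝ] V →L[ℝ] ℝ} (hB : B.IsInvertible)
    (hs : ∀ v w, B v w = B w v) (A : V →L[ℝ] V) : trR (raise B (symPart (B ∘L A))) = trR A := by
  have h : raise B (symPart (B ∘L A)) =
      (1 / 2 : ℝ) • (raise B (B ∘L A) + raise B (B ∘L A).flip) := by
    simp [raise, symPart]
  rw [h, map_smul, map_add, trR_raise_flip hB hs, raise_self_comp hB, smul_eq_mul]
  ring

/-- Symmetry of `H` must not be required: this is applied to the moving metric `perturb G H₂ t`, for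
which `H₁` need not be symmetric. -/
theorem deriv_chernScalLoc_perturb (hJ : ∀ v, J (J v) = -v) (hG : IsJMetricAt J G z)
    (hH : ContDiffAt ℝ 3 H z) (hc : ∀ᶠ y in 𝓝 z, ∀ v, H y (J v) = J (H y v)) :
    HasDerivAt (fun s => chernScalLoc J (perturb G H s) z)
      (1 / 2 * trR (raise (G z) (symPart (G z ∘L H z))
          ∘L raise (G z) (fderiv ℝ (metricTrForm G) z))
        - 1 / 2 * trR (raise (G z) (fderiv ℝ (fderiv ℝ fun y => trR (H y)) z))) 0 := by
  have h := hasDerivAt_chernScalLoc hJ (contDiffAt_uncurry_perturb hG.smooth hH 0)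
    (hG.eventually_perturb hH hc)
  have h0 : perturb G H 0 =ᶠ[𝓝 z] G := hG.symm.mono fun y hy => perturb_zero hy
  have h1 : metricTrForm (perturb G H 0) =ᶠ[𝓝 z] metricTrForm G := by
    filter_upwards [eventually_eventually_nhds.2 h0] with y hy
    have hy' : perturb G H 0 =ᶠ[𝓝 y] G := hy
    rw [metricTrForm, metricTrForm, hy'.fderiv_eq, hy'.self_of_nhds]
  have h2 : (fun y => trR (raise (perturb G H 0 y) (deriv (fun r => perturb G H r y) 0)))
      =ᶠ[𝓝 z] fun y => trR (H y) := by
    filter_upwards [hG.symm, eventually_isInvertible hG.smooth.continuousAt hG.isInvertible]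
      with y hy hy2
    rw [(hasDerivAt_perturb hy 0).deriv, perturb_zero hy, trR_raise_symPart hy2 hy]
  rw [h1.fderiv_eq, h2.fderiv.fderiv_eq, perturb_zero hG.symm_self,
    (hasDerivAt_perturb hG.symm_self 0).deriv] at h
  exact h

theorem fderiv_fderiv_trR (hH : ContDiffAt ℝ 2 H z) :
    fderiv ℝ (fderiv ℝ fun y => trR (H y)) z = (2 : ℝ) • fderiv ℝ (fderiv ℝ fun y => trC (H y)) z := by
  have h1 : ContDiffAt ℝ 2 (fun y => trC (H y)) z := (trC (V := V)).contDiff.contDiffAt.comp z hH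
  have h2 : (fun y => trR (H y)) = fun y => (2 : ℝ) • trC (H y) := by
    ext y
    rw [trC_apply, smul_eq_mul]
    ring
  have h3 : fderiv ℝ (fun y => trR (H y)) =ᶠ[𝓝 z] fun y => (2 : ℝ) • fderiv ℝ (fun y => trC (H y)) y := by
    filter_upwards [h1.eventually (by simp)] with y hy
    rw [h2, fderiv_fun_const_smul (hy.differentiableAt (by norm_num))]
  rw [h3.fderiv_eq, fderiv_fun_const_smul
    ((h1.fderiv_right (m := 1) (by norm_num)).differentiableAt (by norm_num))]

/-- The second variation of the Chern-scalar curvature in a chart. -/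
theorem hasDerivAt_deriv_chernScalLoc {H₁ H₂ : V → V →L[ℝ] V} (hJ : ∀ v, J (J v) = -v)
    (hG : IsJMetricAt J G z) (h₁ : IsSymInvariantAt J G H₁ z) (h₂ : IsSymInvariantAt J G H₂ z) :
    HasDerivAt (fun t => deriv (fun s => chernScalLoc J (perturb (perturb G H₂ t) H₁ s) z) 0)
      (-(1 / 2) * trR (H₁ z ∘L H₂ z ∘L raise (G z) (fderiv ℝ (metricTrForm G) z))
        + trR (H₁ z ∘L raise (G z) (fderiv ℝ (fderiv ℝ fun y => trC (H₂ y)) z))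
        + trR (H₂ z ∘L raise (G z) (fderiv ℝ (fderiv ℝ fun y => trC (H₁ y)) z))) 0 := by
  have hs := hG.symm_self
  have hi := hG.isInvertible
  have hB := contDiffAt_uncurry_perturb hG.smooth h₂.smooth 0
  have h0 : perturb G H₂ 0 z = G z := perturb_zero hs
  have hi0 : (perturb G H₂ 0 z).IsInvertible := by rwa [h0]
  have hB1 : ContDiffAt ℝ 1 (fun t => perturb G H₂ t z) 0 :=
    (contDiffAt_param hB).of_le (by norm_num)
  have hB' := hasDerivAt_perturb (H := H₂) hs 0
  have hGH : symPart (G z ∘L H₂ z) = G z ∘L H₂ z := symPart_eq_self fun v w => by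
    simp only [ContinuousLinearMap.comp_apply]
    rw [hs, h₂.symm_self, hs, hs]
  rw [hGH] at hB'
  have hev : perturb G H₂ 0 =ᶠ[𝓝 z] G := hG.symm.mono fun y hy => perturb_zero hy
  have hform : metricTrForm (perturb G H₂ 0) =ᶠ[𝓝 z] metricTrForm G := by
    filter_upwards [eventually_eventually_nhds.2 hev] with y hy
    have hy' : perturb G H₂ 0 =ᶠ[𝓝 y] G := hy
    rw [metricTrForm, metricTrForm, hy'.fderiv_eq, hy'.self_of_nhds]
  have hD := hasDerivAt_fderiv_metricTrForm hB hi0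
  have hu : (fun y => trR (raise (perturb G H₂ 0 y) (deriv (fun r => perturb G H₂ r y) 0)))
      =ᶠ[𝓝 z] fun y => trR (H₂ y) := by
    filter_upwards [hG.symm, eventually_isInvertible hG.smooth.continuousAt hG.isInvertible]
      with y hy hy2
    rw [(hasDerivAt_perturb hy 0).deriv, perturb_zero hy, trR_raise_symPart hy2 hy]
  rw [hu.fderiv.fderiv_eq, fderiv_fderiv_trR (h₂.smooth.of_le (by norm_num))] at hD
  -- The first differential at time `t` depends on `t` only through the raising metric, this
  -- symmetrized form and the Hessian of `log det`; the Hessian of `tr H₁` is constant in `t`.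
  have hc : HasDerivAt (fun t => symPart (perturb G H₂ t z ∘L H₁ z))
      (symPart ((G z ∘L H₂ z) ∘L H₁ z)) 0 := by
    refine (hasDerivAt_symPart (hB'.clm_comp (hasDerivAt_const (0 : ℝ) (H₁ z)))).congr_deriv ?_
    rw [ContinuousLinearMap.comp_zero, add_zero]
  have hT1 := (trR (V := V)).hasFDerivAt.comp_hasDerivAt (0 : ℝ)
    ((hasDerivAt_raise hB1 hi0 hc).clm_comp (hasDerivAt_raise hB1 hi0 hD))
  have hT2 := (trR (V := V)).hasFDerivAt.comp_hasDerivAt (0 : ℝ) (hasDerivAt_raise hB1 hi0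
    (hasDerivAt_const (0 : ℝ) (fderiv ℝ (fderiv ℝ fun y => trR (H₁ y)) z)))
  have hT := (hT1.const_mul (1 / 2 : ℝ)).sub (hT2.const_mul (1 / 2 : ℝ))
  have hfin := hT.congr_of_eventuallyEq
    (f₁ := fun t => deriv (fun s => chernScalLoc J (perturb (perturb G H₂ t) H₁ s) z) 0) (by
      filter_upwards [hG.eventually_perturb h₂.smooth h₂.comm] with t ht
      exact (deriv_chernScalLoc_perturb hJ ht h₁.smooth h₁.comm).deriv)
  refine hfin.congr_deriv ?_
  rw [hB'.deriv, h0, hform.fderiv_eq, fderiv_fderiv_trR (h₁.smooth.of_le (by norm_num)),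
    raise_self_comp hi]
  set Q := raise (G z) (fderiv ℝ (metricTrForm G) z) with hQ
  have hsym1 : raise (G z) (symPart (G z ∘L H₁ z)) = H₁ z := by
    rw [symPart_eq_self, raise_self_comp hi]
    intro v w
    simp only [ContinuousLinearMap.comp_apply]
    rw [hs, h₁.symm_self, hs, hs]
  -- Subtracting `H₂ H₁`, which comes from the derivative of the inverse metric, leaves half the
  -- commutator `[H₁, H₂]`.
  have hsym2 : raise (G z) (symPart ((G z ∘L H₂ z) ∘L H₁ z)) =
      (1 / 2 : ℝ) • (H₂ z ∘L H₁ z + H₁ z ∘L H₂ z) := by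
    have : symPart ((G z ∘L H₂ z) ∘L H₁ z) =
        G z ∘L ((1 / 2 : ℝ) • (H₂ z ∘L H₁ z + H₁ z ∘L H₂ z)) := by
      ext v w
      simp only [symPart_apply, ContinuousLinearMap.comp_apply, smul_apply, add_apply, map_add,
        map_smul, smul_eq_mul]
      rw [hs (H₂ z (H₁ z w)) v, ← h₂.symm_self, ← h₁.symm_self]
    rw [this, raise_self_comp hi]
  -- All three factors are symmetric, so taking adjoints reverses the product; the commutator term
  -- thus pairs to zero with `Q`.
  have hQs : trR (H₂ z ∘L H₁ z ∘L Q) = trR (H₁ z ∘L H₂ z ∘L Q) := by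
    have hadj : adj (G z) (H₂ z ∘L H₁ z ∘L Q) = Q ∘L H₁ z ∘L H₂ z := adj_eq_of hi fun v w => by
      simp only [ContinuousLinearMap.comp_apply]
      rw [← h₂.symm_self, ← h₁.symm_self, hQ, apply_raise hi, hs, apply_raise hi,
        hG.fderiv_metricTrForm_symm]
    rw [← trR_adj hi, hadj, trR_comp_comm, ContinuousLinearMap.comp_assoc]
  have hsm : ∀ b : V →L[ℝ] V →L[ℝ] ℝ, raise (G z) ((2 : ℝ) • b) = (2 : ℝ) • raise (G z) b :=
    fun b => by simp [raise]
  have hz : raise (G z) 0 = 0 := by simp [raise]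
  rw [hsym1, hsym2, hsm, hsm, hz]
  simp only [ContinuousLinearMap.sub_comp, ContinuousLinearMap.comp_sub,
    ContinuousLinearMap.smul_comp, ContinuousLinearMap.comp_smul, ContinuousLinearMap.add_comp,
    ContinuousLinearMap.comp_assoc, map_sub, map_add, map_smul, smul_eq_mul, zero_sub, map_neg, hQs]
  ring

end SecondVariation

/-! ### From coordinate traces to Hessian, divergences, Lee form, `S` and `dd^c`. -/

section Contractions

variable {V : Type*} [NormedAddCommGroup V] [NormedSpace ℝ V]
variable {J : V →L[ℝ] V} {G : V → V →L[ℝ] V →L[ℝ] ℝ} {H : V → V →L[ℝ] V} {z : V} {u : V → ℝ}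

theorem innerCov_eq {B : V →L[ℝ] V →L[ℝ] ℝ} (hB : B.IsInvertible) (hs : ∀ v w, B v w = B w v)
    (a b : V →L[ℝ] ℝ) : innerCov B a b = b (sharp B a) := by
  rw [innerCov, ← apply_sharp hB a, hs, apply_sharp hB, apply_sharp hB]

/-- `D - ∇`, the difference of the Levi-Civita and the Chern connection. -/
def connDiff (J : V →L[ℝ] V) (G : V → V →L[ℝ] V →L[ℝ] ℝ) (z : V) : V →L[ℝ] V →L[ℝ] V :=
  leviCivita G z - chernConn J G z

theorem leviCivita_eq_add (J : V →L[ℝ] V) (G : V → V →L[ℝ] V →L[ℝ] ℝ) (z : V) :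
    leviCivita G z = chernConn J G z + connDiff J G z := by
  rw [connDiff, add_sub_cancel]

theorem leviCivita_eq_chernConn (h : dTwo (fundFormLoc J G) z = 0) :
    leviCivita G z = chernConn J G z := by
  have h2 : chernForm J G z = leviCivitaForm G z := by
    ext X Y Z
    change leviCivitaForm G z X Y Z - 1 / 2 * dTwo (fundFormLoc J G) z (J X) Y Z = _
    rw [h]
    simp
  rw [leviCivita, chernConn, h2]

theorem ddcLoc_apply (hu : ContDiffAt ℝ 2 u z) (X Y : V) : ddcLoc J u z X Y =
    fderiv ℝ (fderiv ℝ u) z X (J Y) - fderiv ℝ (fderiv ℝ u) z Y (J X) := by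
  have hd : DifferentiableAt ℝ (fderiv ℝ u) z :=
    (hu.fderiv_right (m := 1) (by norm_num)).differentiableAt (by norm_num)
  have h := (hd.hasFDerivAt.clm_comp (hasFDerivAt_const J z)).fderiv
  have h2 : ddcLoc J u z X Y = fderiv ℝ (fun y => fderiv ℝ u y ∘L J) z X Y
    - fderiv ℝ (fun y => fderiv ℝ u y ∘L J) z Y X := rfl
  rw [h2, h]
  simp

theorem rhoInv_ddcLoc {B : V →L[ℝ] V →L[ℝ] ℝ} (hB : B.IsInvertible) (hJ : ∀ v, J (J v) = -v)
    (hi : ∀ v w, B (J v) (J w) = B v w) (hu : ContDiffAt ℝ 2 u z) :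
    rhoInv J B (ddcLoc J u z) = -(raise B (fderiv ℝ (fderiv ℝ u) z)
      - J ∘L raise B (fderiv ℝ (fderiv ℝ u) z) ∘L J) := by
  have hsymm : IsSymmSndFDerivAt ℝ u z := hu.isSymmSndFDerivAt (by simp)
  ext X
  have h := sharp_comp_J hB hJ hi (fderiv ℝ (fderiv ℝ u) z (J X))
  rw [rhoInv_apply]
  simp only [neg_apply, sub_apply, ContinuousLinearMap.comp_apply, raise_apply]
  rw [sub_eq_add_neg, ← h, ← map_add, ← map_neg]
  congr 1
  ext Y
  simp only [ContinuousLinearMap.comp_apply, ddcLoc_apply hu, hJ, map_neg, neg_apply, add_apply]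
  rw [hsymm.eq (J Y) (J X)]
  ring

theorem IsSymInvariantAt.comm_self (h : IsSymInvariantAt J G H z) (v : V) :
    H z (J v) = J (H z v) := h.comm.self_of_nhds v

/-- The first Bianchi identity for a symmetric connection. -/
theorem curv_bianchi {Γ : V → V →L[ℝ] V →L[ℝ] V} (hD : DifferentiableAt ℝ Γ z)
    (hs : ∀ᶠ y in 𝓝 z, ∀ v w, Γ y v w = Γ y w v) (X Y W : V) :
    curv Γ z X Y W + curv Γ z Y W X + curv Γ z W X Y = 0 := by
  have h : ∀ X Y W, fderiv ℝ Γ z X Y W = fderiv ℝ Γ z X W Y := by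
    intro X Y W
    rw [← fderiv_clm_apply_two hD, ← fderiv_clm_apply_two hD,
      Filter.EventuallyEq.fderiv_eq (hs.mono fun y hy => hy Y W)]
  have h0 := hs.self_of_nhds
  simp only [curv_apply, add_apply, sub_apply, ContinuousLinearMap.comp_apply]
  rw [h X Y W, h Y W X, h W X Y, h0 Y W, h0 X W, h0 X Y]
  abel

theorem curv_swap (Γ : V → V →L[ℝ] V →L[ℝ] V) (z X Y W : V) :
    curv Γ z X Y W = -curv Γ z Y X W := by
  simp only [curv_apply, add_apply, sub_apply]
  abel

namespace IsJMetricAt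

theorem leviCivita_symm (hG : IsJMetricAt J G z) (X Y : V) :
    leviCivita G z X Y = leviCivita G z Y X := by
  rw [leviCivita, raiseLast_apply, raiseLast_apply]
  congr 1
  ext Z
  rw [leviCivitaForm_apply, leviCivitaForm_apply, hG.fderiv_symm Z X Y]
  ring

theorem apply_connDiff (hJ : ∀ v, J (J v) = -v) (hG : IsJMetricAt J G z) (X Y Z : V) :
    G z (connDiff J G z X Y) Z = 1 / 2 * (fderiv ℝ G z Y X Z - fderiv ℝ G z Z X Y
      + fderiv ℝ G z (J X) (J Y) Z) := by
  rw [connDiff, leviCivita, chernConn, sub_apply, sub_apply, raiseLast_apply, raiseLast_apply,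
    map_sub, apply_sharp hG.isInvertible, apply_sharp hG.isInvertible, sub_apply,
    leviCivitaForm_apply, hG.chernForm_eq hJ]
  ring

/-- Both connections preserve the metric. Here this is read off the explicit formula and the
`J`-invariance of `D_{JX} G`. -/
theorem connDiff_skew (hJ : ∀ v, J (J v) = -v) (hG : IsJMetricAt J G z) (X Y Z : V) :
    G z (connDiff J G z X Y) Z = -G z Y (connDiff J G z X Z) := by
  have h := hG.fderiv_inv (J X) (J Y) Z
  rw [hJ, map_neg, neg_apply] at h
  rw [hG.symm_self Y, hG.apply_connDiff hJ, hG.apply_connDiff hJ, hG.fderiv_symm (J X) (J Z) Y, ← h]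
  ring

theorem raise_comp_connDiff (hJ : ∀ v, J (J v) = -v) (hG : IsJMetricAt J G z) (a : V →L[ℝ] ℝ) :
    raise (G z) (ContinuousLinearMap.compL ℝ V V ℝ a ∘L connDiff J G z)
      = -(connDiff J G z).flip (sharp (G z) a) := by
  ext X
  symm
  refine eq_sharp_of hG.isInvertible fun Z => ?_
  rw [neg_apply, ContinuousLinearMap.flip_apply, map_neg, neg_apply, hG.connDiff_skew hJ, neg_neg,
    apply_sharp hG.isInvertible]
  rfl

variable [FiniteDimensional ℝ V]

/-- The contraction of the Chern connection with a symmetric endomorphism commuting with `J`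
vanishes in holomorphic coordinates. -/
theorem trR_raise_comp_chernConn (hJ : ∀ v, J (J v) = -v) (hG : IsJMetricAt J G z)
    {A : V →L[ℝ] V} (hA : ∀ v, A (J v) = J (A v)) (a : V →L[ℝ] ℝ) :
    trR (raise (G z) (ContinuousLinearMap.compL ℝ V V ℝ a ∘L chernConn J G z) ∘L A) = 0 := by
  -- Complex bilinearity of the Christoffel symbol makes the raised form anticommute with `J`, and
  -- composing with `A` keeps this.
  refine trR_eq_zero_of_anticomm hJ fun v => ?_
  rw [ContinuousLinearMap.comp_apply, ContinuousLinearMap.comp_apply, raise_apply, raise_apply,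
    ← sharp_comp_J hG.isInvertible hJ hG.inv_self]
  congr 1
  ext w
  simp [hA, hG.chernConn_J_left hJ, hG.chernConn_J_right hJ]

theorem adj_hessLoc_and_trR_hessLoc_comp (hJ : ∀ v, J (J v) = -v) (hG : IsJMetricAt J G z)
    {A : V →L[ℝ] V} (hA : ∀ v, A (J v) = J (A v)) (hu : ContDiffAt ℝ 2 u z) :
    adj (G z) (hessLoc G u z) = hessLoc G u z ∧
    trR (hessLoc G u z ∘L A) = trR (raise (G z) (fderiv ℝ (fderiv ℝ u) z) ∘L A)
      + trR ((connDiff J G z).flip (sharp (G z) (fderiv ℝ u z)) ∘L A) := by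
  have hsymm : IsSymmSndFDerivAt ℝ u z := hu.isSymmSndFDerivAt (by simp)
  constructor
  · rw [hessLoc, adj_raise hG.isInvertible hG.symm_self]
    congr 1
    ext X Y
    simp only [ContinuousLinearMap.flip_apply, sub_apply, ContinuousLinearMap.comp_apply,
      ContinuousLinearMap.compL_apply]
    rw [hsymm.eq X Y, hG.leviCivita_symm X Y]
  · have h : hessLoc G u z = raise (G z) (fderiv ℝ (fderiv ℝ u) z)
        - raise (G z) (ContinuousLinearMap.compL ℝ V V ℝ (fderiv ℝ u z) ∘L chernConn J G z)
        - raise (G z) (ContinuousLinearMap.compL ℝ V V ℝ (fderiv ℝ u z) ∘L connDiff J G z) := by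
      rw [hessLoc, leviCivita_eq_add J]
      simp only [raise, ContinuousLinearMap.comp_sub, ContinuousLinearMap.comp_add]
      abel
    rw [h, hG.raise_comp_connDiff hJ, ContinuousLinearMap.sub_comp, ContinuousLinearMap.sub_comp,
      map_sub, map_sub, hG.trR_raise_comp_chernConn hJ hA, ContinuousLinearMap.neg_comp, map_neg]
    ring

/-- The derivatives of `H` cancel, leaving the algebraic action of `C = D - ∇` on `H`. -/
theorem divLoc_sub (J : V →L[ℝ] V) (G : V → V →L[ℝ] V →L[ℝ] ℝ) (H : V → V →L[ℝ] V) (z v : V) :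
    (divLoc (leviCivita G) H z - divLoc (chernConn J G) H z) v =
      trR ((connDiff J G z).flip (H z v)) - trR (H z ∘L (connDiff J G z).flip v) := by
  have h : ∀ Γ : V → V →L[ℝ] V →L[ℝ] V,
      divLoc Γ H z v = trR ((covDerEnd Γ H z).flip v) := fun _ => rfl
  rw [sub_apply, h, h, ← map_sub, ← map_sub]
  congr 1
  ext X
  simp only [connDiff, sub_apply, ContinuousLinearMap.flip_apply, covDerEnd_apply,
    ContinuousLinearMap.comp_apply, map_sub]
  abel

/-- Since `D` is torsion-free, `T(v, X) = C(X, v) - C(v, X)`, and `C(v, ·)` is skew, hence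
trace-free. -/
theorem leeLoc_apply (hJ : ∀ v, J (J v) = -v) (hG : IsJMetricAt J G z) (v : V) :
    leeLoc J G z v = trR ((connDiff J G z).flip v) := by
  have h1 : trR (connDiff J G z v) = 0 :=
    trR_eq_zero_of_skew hG.isInvertible fun X Y => hG.connDiff_skew hJ v X Y
  have h2 : leeLoc J G z v = trR ((connDiff J G z).flip v - connDiff J G z v) := by
    refine congrArg trR ?_
    ext X
    change chernConn J G z v X - chernConn J G z X v = _
    simp only [connDiff, sub_apply, ContinuousLinearMap.flip_apply, hG.leviCivita_symm X v]
    abel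
  rw [h2, map_sub, h1, sub_zero]

/-- The first three terms of the second variation combine into a contraction of the coordinate
Hessian. -/
theorem hess_add_div_sub_lee (hJ : ∀ v, J (J v) = -v) (hG : IsJMetricAt J G z)
    (hc : ∀ v, H z (J v) = J (H z v)) (hu : ContDiffAt ℝ 2 u z) :
    innerEnd (G z) (hessLoc G u z) (H z)
      + innerCov (G z) (fderiv ℝ u z) (divLoc (leviCivita G) H z - divLoc (chernConn J G) H z)
      - innerCov (G z) (fderiv ℝ u z) (leeLoc J G z ∘L H z)
      = trR (H z ∘L raise (G z) (fderiv ℝ (fderiv ℝ u) z)) := by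
  obtain ⟨h1, h2⟩ := hG.adj_hessLoc_and_trR_hessLoc_comp hJ hc hu
  -- With `v` the gradient of `u`, the Hessian contributes the trace of `C(·, v) ∘ H`, which the
  -- second term of the divergence difference removes; its first term, the trace of `C(·, Hv)`, is
  -- exactly the Lee term.
  rw [innerCov_eq hG.isInvertible hG.symm_self, innerCov_eq hG.isInvertible hG.symm_self,
    divLoc_sub, ContinuousLinearMap.comp_apply, hG.leeLoc_apply hJ, innerEnd, h1, h2,
    trR_comp_comm (H z) (raise _ _), trR_comp_comm (H z) ((connDiff J G z).flip _)]
  ring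

end IsJMetricAt

variable [FiniteDimensional ℝ V]

/-- `Q - JQJ` is twice the `J`-commuting part of `Q`, the only part that `A` detects. -/
theorem trR_comp_J_conj (hJ : ∀ v, J (J v) = -v) {A : V →L[ℝ] V} (hA : ∀ v, A (J v) = J (A v))
    (Q : V →L[ℝ] V) : trR (A ∘L (Q - J ∘L Q ∘L J)) = 2 * trR (A ∘L Q) := by
  have h : A ∘L (J ∘L Q ∘L J) = J ∘L (A ∘L Q) ∘L J := by ext v; simp [hA]
  rw [ContinuousLinearMap.comp_sub, map_sub, h, trR_J_conj hJ]
  ring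

theorem IsSymInvariantAt.innerEnd_eq (hG : IsJMetricAt J G z) (h : IsSymInvariantAt J G H z)
    (C : V →L[ℝ] V) : innerEnd (G z) (H z) C = trR (H z ∘L C) := by
  rw [innerEnd, adj_eq_self hG.isInvertible h.symm_self]

theorem IsSymInvariantAt.contDiffAt_trC (h : IsSymInvariantAt J G H z) :
    ContDiffAt ℝ 2 (fun y => trC (H y)) z :=
  (trC (V := V)).contDiff.contDiffAt.comp z (h.smooth.of_le (by norm_num))

variable {H₁ H₂ : V → V →L[ℝ] V}

theorem secondVariation_eq (hJ : ∀ v, J (J v) = -v)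
    (hG : IsJMetricAt J G z) (h₁ : IsSymInvariantAt J G H₁ z) (h₂ : IsSymInvariantAt J G H₂ z) :
    -(1 / 2) * trR (H₁ z ∘L H₂ z ∘L raise (G z) (fderiv ℝ (metricTrForm G) z))
        + trR (H₁ z ∘L raise (G z) (fderiv ℝ (fderiv ℝ fun y => trC (H₂ y)) z))
        + trR (H₂ z ∘L raise (G z) (fderiv ℝ (fderiv ℝ fun y => trC (H₁ y)) z)) =
      innerEnd (G z) (hessLoc G (fun y => trC (H₁ y)) z) (H₂ z)
        + innerCov (G z) (fderiv ℝ (fun y => trC (H₁ y)) z)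
          (divLoc (leviCivita G) H₂ z - divLoc (chernConn J G) H₂ z)
        - innerCov (G z) (fderiv ℝ (fun y => trC (H₁ y)) z) (leeLoc J G z ∘L H₂ z)
        + innerEnd (G z) (H₁ z) (H₂ z ∘L chernRicciLoc J G z)
        - 1 / 2 * innerEnd (G z) (H₁ z)
          (rhoInv J (G z) (ddcLoc J (fun y => trC (H₂ y)) z)) := by
  have hc : ∀ v, (H₁ z ∘L H₂ z) (J v) = J ((H₁ z ∘L H₂ z) v) := fun v => by
    simp [h₁.comm_self, h₂.comm_self]
  have hS := trR_comp_J_conj hJ hc (raise (G z) (fderiv ℝ (metricTrForm G) z))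
  rw [ContinuousLinearMap.comp_assoc, ContinuousLinearMap.comp_assoc] at hS
  rw [hG.hess_add_div_sub_lee hJ h₂.comm_self h₁.contDiffAt_trC, h₁.innerEnd_eq hG,
    h₁.innerEnd_eq hG, hG.chernRicciLoc_eq hJ,
    rhoInv_ddcLoc hG.isInvertible hJ hG.inv_self h₂.contDiffAt_trC,
    ContinuousLinearMap.comp_neg, map_neg, trR_comp_J_conj hJ h₁.comm_self,
    ContinuousLinearMap.comp_smul, ContinuousLinearMap.comp_smul, map_smul, hS,
    smul_eq_mul]
  ring

end Contractions

/-! ### The Kähler case: Ricci curvature from the Bianchi identity. -/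

section Kaehler

variable {V : Type*} [NormedAddCommGroup V] [NormedSpace ℝ V] [FiniteDimensional ℝ V]
variable {J : V →L[ℝ] V} {G : V → V →L[ℝ] V →L[ℝ] ℝ} {H H₁ H₂ : V → V →L[ℝ] V} {z : V}

theorem IsJMetricAt.curv_chernConn_J (hJ : ∀ v, J (J v) = -v) (hG : IsJMetricAt J G z)
    (X Y W : V) :
    curv (chernConn J G) z X Y (J W) = J (curv (chernConn J G) z X Y W) := by
  have hD : DifferentiableAt ℝ (chernConn J G) z :=
    hG.contDiffAt_chernConn.differentiableAt (by norm_num)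
  have h : ∀ X Y W, fderiv ℝ (chernConn J G) z X Y (J W) =
      J (fderiv ℝ (chernConn J G) z X Y W) := by
    intro X Y W
    rw [← fderiv_clm_apply_two hD, ← fderiv_clm_apply_two hD]
    have h1 : (fun y => chernConn J G y Y (J W)) =ᶠ[𝓝 z] J ∘ fun y => chernConn J G y Y W := by
      filter_upwards [hG.eventually] with y hy
      exact hy.chernConn_J_right hJ Y W
    have hd2 : DifferentiableAt ℝ (fun y => chernConn J G y Y W) z :=
      (hD.clm_apply (differentiableAt_const Y)).clm_apply (differentiableAt_const W)
    rw [h1.fderiv_eq, (J.hasFDerivAt.comp z hd2.hasFDerivAt).fderiv]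
    rfl
  simp only [curv_apply, add_apply, sub_apply, ContinuousLinearMap.comp_apply, map_add, map_sub,
    h, hG.chernConn_J_right hJ]

/-- Closedness is needed on a neighbourhood, since the curvature differentiates the connection. -/
theorem ricciForm_apply_of_kaehler (hK : ∀ᶠ y in 𝓝 z, dTwo (fundFormLoc J G) y = 0)
    (X Y : V) : ricciForm G z X Y =
    trR (((curv (chernConn J G) z).flip X).flip Y) := by
  have h : leviCivita G =ᶠ[𝓝 z] chernConn J G := hK.mono fun y hy => leviCivita_eq_chernConn hy
  have h2 : curv (leviCivita G) z = curv (chernConn J G) z := by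
    rw [curv, curv, secondDer, secondDer, h.fderiv_eq, h.self_of_nhds]
  rw [ricciForm_apply, h2]

theorem curv_bianchi_of_kaehler (hG : IsJMetricAt J G z)
    (hK : ∀ᶠ y in 𝓝 z, dTwo (fundFormLoc J G) y = 0) (X Y W : V) :
    curv (chernConn J G) z X Y W + curv (chernConn J G) z Y W X + curv (chernConn J G) z W X Y
      = 0 := by
  refine curv_bianchi (hG.contDiffAt_chernConn.differentiableAt (by norm_num)) ?_ X Y W
  filter_upwards [hK, hG.eventually] with y hy hy2 v w
  rw [← leviCivita_eq_chernConn hy, hy2.leviCivita_symm]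

/-- By the Bianchi identity the skew part is a trace of the curvature operator, which vanishes. -/
theorem ricciForm_symm_of_kaehler (hJ : ∀ v, J (J v) = -v) (hG : IsJMetricAt J G z)
    (hK : ∀ᶠ y in 𝓝 z, dTwo (fundFormLoc J G) y = 0) (X Y : V) : ricciForm G z X Y = ricciForm G z Y X := by
  rw [← sub_eq_zero, ricciForm_apply_of_kaehler hK, ricciForm_apply_of_kaehler hK,
    ← map_sub, show ((curv (chernConn J G) z).flip X).flip Y - ((curv (chernConn J G) z).flip Y).flip X
      = -curv (chernConn J G) z X Y from ?_, map_neg, hG.trR_curv_chernConn hJ, neg_zero]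
  ext W
  have h := curv_bianchi_of_kaehler hG hK X Y W
  rw [curv_swap _ _ Y W] at h
  simp only [sub_apply, ContinuousLinearMap.flip_apply, neg_apply]
  rw [eq_neg_iff_add_eq_zero, ← h]
  abel

theorem ricciForm_add_J (hJ : ∀ v, J (J v) = -v) (hG : IsJMetricAt J G z)
    (hK : ∀ᶠ y in 𝓝 z, dTwo (fundFormLoc J G) y = 0) (X Y : V) : ricciForm G z X Y + ricciForm G z (J X) (J Y) =
    -(1 / 2) * (fderiv ℝ (metricTrForm G) z X Y + fderiv ℝ (metricTrForm G) z (J X) (J Y)) := by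
  have h := hG.trR_J_curv_chernConn hJ X (J Y)
  -- Apply `J` to the Bianchi identity for `X`, `JY`, `W` and move it inside the curvature: `J R(X,
  -- JY)W = R(W, X)Y + R(W, JY)JX`. The trace in `W` is a sum of two Ricci terms.
  have h2 : J ∘L curv (chernConn J G) z X (J Y) = ((curv (chernConn J G) z).flip X).flip Y
      + ((curv (chernConn J G) z).flip (J Y)).flip (J X) := by
    ext W
    have hb := curv_bianchi_of_kaehler hG hK X (J Y) W
    rw [curv_swap _ _ (J Y) W] at hb
    have hb2 := congrArg J hb
    simp only [map_add, map_neg, ← hG.curv_chernConn_J hJ, hJ, map_zero] at hb2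
    simp only [ContinuousLinearMap.comp_apply, add_apply, ContinuousLinearMap.flip_apply]
    rw [← hG.curv_chernConn_J hJ, ← sub_eq_zero, ← hb2]
    abel
  rw [h2, map_add, ← ricciForm_apply_of_kaehler hK, ← ricciForm_apply_of_kaehler hK,
    ricciForm_symm_of_kaehler hJ hG hK (J Y), hJ, map_neg,
    hG.fderiv_metricTrForm_symm (J Y)] at h
  rw [h]
  ring

/-- `A` only detects the `J`-commuting part, so `J`-invariance of the Ricci form itself need not be
proved. -/
theorem trR_comp_ricciLoc (hJ : ∀ v, J (J v) = -v) (hG : IsJMetricAt J G z)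
    (hK : ∀ᶠ y in 𝓝 z, dTwo (fundFormLoc J G) y = 0) {A : V →L[ℝ] V} (hA : ∀ v, A (J v) = J (A v)) :
    trR (A ∘L ricciLoc G z) =
      -(1 / 2) * trR (A ∘L raise (G z) (fderiv ℝ (metricTrForm G) z)) := by
  have h : ricciLoc G z - J ∘L ricciLoc G z ∘L J = -(1 / 2 : ℝ) •
      (raise (G z) (fderiv ℝ (metricTrForm G) z)
        - J ∘L raise (G z) (fderiv ℝ (metricTrForm G) z) ∘L J) := by
    ext X
    simp only [ricciLoc, smul_apply, sub_apply, ContinuousLinearMap.comp_apply, raise_apply]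
    rw [sub_eq_add_neg, sub_eq_add_neg, ← sharp_comp_J hG.isInvertible hJ hG.inv_self,
      ← sharp_comp_J hG.isInvertible hJ hG.inv_self, ← map_add, ← map_add, ← map_smul]
    congr 1
    ext Y
    exact ricciForm_add_J hJ hG hK X Y
  have h2 := trR_comp_J_conj hJ hA (ricciLoc G z)
  rw [h, ContinuousLinearMap.comp_smul, map_smul, trR_comp_J_conj hJ hA, smul_eq_mul] at h2
  linarith

theorem trR_hessLoc_of_kaehler (hJ : ∀ v, J (J v) = -v) (hG : IsJMetricAt J G z)
    (hK : ∀ᶠ y in 𝓝 z, dTwo (fundFormLoc J G) y = 0) {u : V → ℝ} {A : V →L[ℝ] V} (hA : ∀ v, A (J v) = J (A v))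
    (hu : ContDiffAt ℝ 2 u z) :
    trR (hessLoc G u z ∘L A) = trR (A ∘L raise (G z) (fderiv ℝ (fderiv ℝ u) z)) := by
  have h0 : connDiff J G z = 0 := sub_eq_zero.2 (leviCivita_eq_chernConn hK.self_of_nhds)
  rw [(hG.adj_hessLoc_and_trR_hessLoc_comp hJ hA hu).2, h0, trR_comp_comm A]
  have h1 : (0 : V →L[ℝ] V →L[ℝ] V).flip (sharp (G z) (fderiv ℝ u z)) = 0 := rfl
  rw [h1, ContinuousLinearMap.zero_comp, map_zero, add_zero]

theorem secondVariation_eq_of_kaehler (hJ : ∀ v, J (J v) = -v) (hG : IsJMetricAt J G z)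
    (hK : ∀ᶠ y in 𝓝 z, dTwo (fundFormLoc J G) y = 0)
    (h₁ : IsSymInvariantAt J G H₁ z) (h₂ : IsSymInvariantAt J G H₂ z) :
    -(1 / 2) * trR (H₁ z ∘L H₂ z ∘L raise (G z) (fderiv ℝ (metricTrForm G) z))
        + trR (H₁ z ∘L raise (G z) (fderiv ℝ (fderiv ℝ fun y => trC (H₂ y)) z))
        + trR (H₂ z ∘L raise (G z) (fderiv ℝ (fderiv ℝ fun y => trC (H₁ y)) z)) =
      innerEnd (G z) (hessLoc G (fun y => trC (H₁ y)) z) (H₂ z)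
        + innerEnd (G z) (H₁ z) (hessLoc G (fun y => trC (H₂ y)) z)
        + innerEnd (G z) (H₁ z) (H₂ z ∘L ricciLoc G z) := by
  have hc : ∀ v, (H₁ z ∘L H₂ z) (J v) = J ((H₁ z ∘L H₂ z) v) := fun v => by
    simp [h₁.comm_self, h₂.comm_self]
  have hS := trR_comp_ricciLoc hJ hG hK hc
  rw [ContinuousLinearMap.comp_assoc, ContinuousLinearMap.comp_assoc] at hS
  rw [h₁.innerEnd_eq hG, h₁.innerEnd_eq hG, innerEnd,
    (hG.adj_hessLoc_and_trR_hessLoc_comp hJ h₂.comm_self h₁.contDiffAt_trC).1,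
    trR_hessLoc_of_kaehler hJ hG hK h₂.comm_self h₁.contDiffAt_trC, trR_comp_comm (H₁ z) (hessLoc _ _ _),
    trR_hessLoc_of_kaehler hJ hG hK h₁.comm_self h₂.contDiffAt_trC, hS]
  ring

end Kaehler

/-! ### Smoothness and complex linearity of the chart representations. -/

section ChartDerivative

variable {E : Type*} [NormedAddCommGroup E] [NormedSpace ℂ E]
  {M : Type*} [TopologicalSpace M] [ChartedSpace E M]

/-- The differential of the inverse of the chart at `c`. -/
def chartDeriv (c : M) (z : E) : E →L[ℝ] E :=
  mfderiv 𝓘(ℝ, E) 𝓘(ℝ, E) (extChartAt 𝓘(ℝ, E) c).symm z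

/-- The value of a bilinear field, with the tangent space identified with the model space. -/
def bilinAt (g : BilinField E M) (y : M) : E →L[ℝ] E →L[ℝ] ℝ := g y

/-- The value of an endomorphism field, with the tangent space identified with the model space. -/
def endAt (h : EndField E M) (y : M) : E →L[ℝ] E := h y

theorem bilinAt_vary (g : BilinField E M) (h : EndField E M) (s : ℝ) (y : M) (v w : E) :
    bilinAt (vary g h s) y v w =
      1 / 2 * (bilinAt g y (v + s • endAt h y v) w + bilinAt g y (w + s • endAt h y w) v) := rfl

theorem chartMetric_apply (g : BilinField E M) (c : M) (z v w : E) :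
    chartMetric g c z v w =
      bilinAt g ((extChartAt 𝓘(ℝ, E) c).symm z) (chartDeriv c z v) (chartDeriv c z w) := rfl

theorem chartEnd_apply (h : EndField E M) (c : M) (z v : E) :
    chartEnd h c z v = ContinuousLinearMap.inverse (chartDeriv c z)
      (endAt h ((extChartAt 𝓘(ℝ, E) c).symm z) (chartDeriv c z v)) := rfl

variable [IsManifold 𝓘(ℂ, E) ω M]

theorem isInvertible_chartDeriv {c : M} {z : E} (hz : z ∈ (extChartAt 𝓘(ℝ, E) c).target) :
    (chartDeriv c z).IsInvertible := by
  have h := isInvertible_mfderivWithin_extChartAt_symm (I := 𝓘(ℝ, E)) hz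
  rw [modelWithCornersSelf_coe, Set.range_id, mfderivWithin_univ] at h
  exact h

theorem symmL_trivializationAt_eq_chartDeriv {c y : M} (hy : y ∈ (chartAt E c).source) :
    (trivializationAt E (TangentSpace 𝓘(ℝ, E)) c).symmL ℝ y =
      chartDeriv c (extChartAt 𝓘(ℝ, E) c y) := by
  have h := TangentBundle.symmL_trivializationAt (I := 𝓘(ℝ, E)) hy
  rw [modelWithCornersSelf_coe, Set.range_id, mfderivWithin_univ] at h
  exact h

theorem chartDeriv_self (c : M) :
    chartDeriv c (extChartAt 𝓘(ℝ, E) c c) = ContinuousLinearMap.id ℝ E := by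
  have h := mfderivWithin_range_extChartAt_symm (I := 𝓘(ℝ, E)) (x := c)
  rw [modelWithCornersSelf_coe, Set.range_id, mfderivWithin_univ] at h
  exact h

/-- The tangent space at each point is `E` through the preferred chart there, so the differential of
an inverse chart is that of a coordinate change. This is how holomorphy reaches `chartDeriv`. -/
theorem chartDeriv_eq_fderiv {c : M} {z : E} (hz : z ∈ (extChartAt 𝓘(ℝ, E) c).target) :
    chartDeriv c z = fderiv ℝ (extChartAt 𝓘(ℝ, E) ((extChartAt 𝓘(ℝ, E) c).symm z) ∘
      (extChartAt 𝓘(ℝ, E) c).symm) z := by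
  set y := (extChartAt 𝓘(ℝ, E) c).symm z with hy
  have hys : y ∈ (chartAt E c).source := by
    rw [← extChartAt_source 𝓘(ℝ, E)]; exact (extChartAt 𝓘(ℝ, E) c).map_target hz
  have h1 := symmL_trivializationAt_eq_chartDeriv hys
  have h2 := TangentBundle.symmL_trivializationAt_eq_core (I := 𝓘(ℝ, E)) hys
  have hzy : extChartAt 𝓘(ℝ, E) c y = z := (extChartAt 𝓘(ℝ, E) c).right_inv hz
  have h3 : tangentCoordChange 𝓘(ℝ, E) c y y = _ := tangentCoordChange_def
  rw [hzy] at h1 h3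
  rw [modelWithCornersSelf_coe, Set.range_id, fderivWithin_univ] at h3
  rw [← h3]
  exact h1.symm.trans h2

theorem cplxStr_cplxStr (v : E) : cplxStr (cplxStr v) = -v := by
  simp [smul_smul]

theorem contDiffAt_coordChange {c d : M} {z : E} (hz : z ∈ (extChartAt 𝓘(ℝ, E) c).target)
    (hd : (extChartAt 𝓘(ℝ, E) c).symm z ∈ (extChartAt 𝓘(ℝ, E) d).source) :
    ContDiffAt ℂ ω (extChartAt 𝓘(ℝ, E) d ∘ (extChartAt 𝓘(ℝ, E) c).symm) z := by
  have h := contDiffWithinAt_ext_coord_change (I := 𝓘(ℂ, E)) (n := ω) d c (y := z) (by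
    rw [PartialEquiv.trans_source, PartialEquiv.symm_source]
    exact ⟨hz, hd⟩)
  rw [modelWithCornersSelf_coe, Set.range_id, contDiffWithinAt_univ] at h
  exact h

/-- Holomorphic coordinate changes have complex linear differentials. -/
theorem fderiv_coordChange_J {c d : M} {z : E} (hz : z ∈ (extChartAt 𝓘(ℝ, E) c).target)
    (hd : (extChartAt 𝓘(ℝ, E) c).symm z ∈ (extChartAt 𝓘(ℝ, E) d).source) (v : E) :
    fderiv ℝ (extChartAt 𝓘(ℝ, E) d ∘ (extChartAt 𝓘(ℝ, E) c).symm) z (cplxStr v) =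
      cplxStr (fderiv ℝ (extChartAt 𝓘(ℝ, E) d ∘ (extChartAt 𝓘(ℝ, E) c).symm) z v) := by
  have h := ((contDiffAt_coordChange hz hd).differentiableAt (by simp)).hasFDerivAt.restrictScalars ℝ
  rw [h.fderiv]
  simp

theorem chartDeriv_J {c : M} {z : E} (hz : z ∈ (extChartAt 𝓘(ℝ, E) c).target) (v : E) :
    chartDeriv c z (cplxStr v) = cplxStr (chartDeriv c z v) := by
  rw [chartDeriv_eq_fderiv hz]
  exact fderiv_coordChange_J hz (mem_extChartAt_source _) v

theorem contDiffAt_of_contMDiffAt_comp_chart {F : Type*} [NormedAddCommGroup F] [NormedSpace ℝ F]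
    {f : E → F} {c : M}
    (hf : ContMDiffAt 𝓘(ℝ, E) 𝓘(ℝ, F) ∞ (fun y : M => f (extChartAt 𝓘(ℝ, E) c y)) c) :
    ContDiffAt ℝ ∞ f (extChartAt 𝓘(ℝ, E) c c) := by
  rw [← contMDiffAt_iff_contDiffAt]
  have hn : (extChartAt 𝓘(ℝ, E) c).target ∈ 𝓝 (extChartAt 𝓘(ℝ, E) c c) :=
    (isOpen_extChartAt_target c).mem_nhds (mem_extChartAt_target c)
  have h1 : ContMDiffAt 𝓘(ℝ, E) 𝓘(ℝ, E) ∞ (extChartAt 𝓘(ℝ, E) c).symm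
      (extChartAt 𝓘(ℝ, E) c c) :=
    (contMDiffOn_extChartAt_symm c).contMDiffAt hn
  have h2 := ContMDiffAt.comp_of_eq hf h1 (extChartAt_to_inv c)
  refine h2.congr_of_eventuallyEq ?_
  filter_upwards [hn] with z hz
  simp only [Function.comp_apply, (extChartAt 𝓘(ℝ, E) c).right_inv hz]

theorem contDiffAt_chartMetric {g : BilinField E M} (hg : IsHermitianMetric g) (c : M) :
    ContDiffAt ℝ ∞ (chartMetric g c) (extChartAt 𝓘(ℝ, E) c c) := by
  have h1 := ((contMDiffAt_hom_bundle _).1 (hg.smooth c)).2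
  refine contDiffAt_of_contMDiffAt_comp_chart (h1.congr_of_eventuallyEq ?_)
  filter_upwards [(chartAt E c).open_source.mem_nhds (mem_chart_source E c)] with y hy
  have hb' : y ∈ (trivializationAt (E →L[ℝ] ℝ)
    (fun x : M => TangentSpace 𝓘(ℝ, E) x →L[ℝ] ℝ) c).baseSet := ⟨hy, trivial⟩
  have hy2 : (extChartAt 𝓘(ℝ, E) c).symm (extChartAt 𝓘(ℝ, E) c y) = y :=
    (extChartAt 𝓘(ℝ, E) c).left_inv (by rwa [extChartAt_source])
  ext v w
  rw [chartMetric_apply, hy2, ContinuousLinearMap.inCoordinates, ContinuousLinearMap.comp_apply,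
    ContinuousLinearMap.comp_apply, symmL_trivializationAt_eq_chartDeriv hy]
  simp only [Bundle.Trivialization.continuousLinearMapAt_apply,
    Bundle.Trivialization.coe_linearMapAt_of_mem _ hb', hom_trivializationAt_apply,
    ContinuousLinearMap.inCoordinates, ContinuousLinearMap.comp_apply,
    symmL_trivializationAt_eq_chartDeriv hy]
  -- The values lie in the trivial line bundle, whose trivialization acts as the identity on fibres.
  have ht : ∀ r : ℝ, Bundle.Trivialization.linearMapAt ℝ
      (trivializationAt ℝ (Bundle.Trivial M ℝ) c) y r = r := fun r =>
    congrArg (fun L : ℝ →ₗ[ℝ] ℝ => L r) (Bundle.Trivial.linearMapAt_trivialization ℝ M ℝ y)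
  exact (ht _).symm

theorem contDiffAt_chartEnd {g : BilinField E M} {h : EndField E M} (hh : IsSymInvariant g h)
    (c : M) : ContDiffAt ℝ ∞ (chartEnd h c) (extChartAt 𝓘(ℝ, E) c c) := by
  have h1 := ((contMDiffAt_hom_bundle _).1 (hh.smooth c)).2
  refine contDiffAt_of_contMDiffAt_comp_chart (h1.congr_of_eventuallyEq ?_)
  filter_upwards [(chartAt E c).open_source.mem_nhds (mem_chart_source E c)] with y hy
  have hys : y ∈ (extChartAt 𝓘(ℝ, E) c).source := by rwa [extChartAt_source]
  have hy2 : (extChartAt 𝓘(ℝ, E) c).symm (extChartAt 𝓘(ℝ, E) c y) = y :=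
    (extChartAt 𝓘(ℝ, E) c).left_inv hys
  have hb : y ∈ (trivializationAt E (TangentSpace 𝓘(ℝ, E)) c).baseSet := hy
  have hinv : ∀ w : E, ContinuousLinearMap.inverse (chartDeriv c (extChartAt 𝓘(ℝ, E) c y)) w =
      (trivializationAt E (TangentSpace 𝓘(ℝ, E)) c).continuousLinearMapAt ℝ y w := by
    intro w
    have hi := isInvertible_chartDeriv ((extChartAt 𝓘(ℝ, E) c).map_source hys)
    rw [hi.inverse_apply_eq, ← symmL_trivializationAt_eq_chartDeriv hy]
    exact (Bundle.Trivialization.symmL_continuousLinearMapAt _ hb w).symm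
  ext v
  rw [chartEnd_apply, hy2, ContinuousLinearMap.inCoordinates, ContinuousLinearMap.comp_apply,
    ContinuousLinearMap.comp_apply, symmL_trivializationAt_eq_chartDeriv hy]
  exact hinv _

end ChartDerivative

/-! ### Dependence on germs only, and pullback of exterior derivatives. -/

section Germs

variable {V : Type*} [NormedAddCommGroup V] [NormedSpace ℝ V]
  {J : V →L[ℝ] V} {G G' : V → V →L[ℝ] V →L[ℝ] ℝ} {z : V}

theorem chernConn_congr (h : G =ᶠ[𝓝 z] G') : chernConn J G =ᶠ[𝓝 z] chernConn J G' := by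
  filter_upwards [eventually_eventually_nhds.2 h] with y hy
  have hy' : G =ᶠ[𝓝 y] G' := hy
  have hw : fundFormLoc J G =ᶠ[𝓝 y] fundFormLoc J G' := by
    filter_upwards [hy'] with p hp
    rw [fundFormLoc, fundFormLoc, hp]
  rw [chernConn, chernConn, chernForm, chernForm, leviCivitaForm, leviCivitaForm, dTwo, dTwo,
    hy'.fderiv_eq, hw.fderiv_eq, hy'.self_of_nhds]

theorem chernScalLoc_congr [FiniteDimensional ℝ V] (h : G =ᶠ[𝓝 z] G') :
    chernScalLoc J G z = chernScalLoc J G' z := by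
  have hc := chernConn_congr (J := J) h
  rw [chernScalLoc, chernScalLoc, chernRicciForm, chernRicciForm, chernCurv, chernCurv, curv, curv,
    secondDer, secondDer, hc.fderiv_eq, hc.self_of_nhds, h.self_of_nhds]

theorem ddcLoc_congr {u u' : V → ℝ} (h : u =ᶠ[𝓝 z] u') : ddcLoc J u z = ddcLoc J u' z := by
  have h1 : (fun y : V => fderiv ℝ u y ∘L J) =ᶠ[𝓝 z] fun y => fderiv ℝ u' y ∘L J := by
    filter_upwards [h.fderiv (𝕜 := ℝ)] with y hy
    rw [hy]
  rw [ddcLoc, ddcLoc, dOne, dOne, h1.fderiv_eq]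

/-- A form near `z` pulled back by `f` has pulled back exterior derivative. -/
theorem dTwo_pullback {w w' : V → V →L[ℝ] V →L[ℝ] ℝ} {f : V → V}
    (hf : ContDiffAt ℝ 2 f z) (hw' : DifferentiableAt ℝ w' (f z))
    (hskew : ∀ X Y, w' (f z) X Y = -w' (f z) Y X)
    (h : ∀ᶠ y in 𝓝 z, ∀ X Y, w y X Y = w' (f y) (fderiv ℝ f y X) (fderiv ℝ f y Y))
    (hw : DifferentiableAt ℝ w z) (X Y Z : V) :
    dTwo w z X Y Z = dTwo w' (f z) (fderiv ℝ f z X) (fderiv ℝ f z Y) (fderiv ℝ f z Z) := by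
  have hD : DifferentiableAt ℝ (fderiv ℝ f) z :=
    (hf.fderiv_right (m := 1) (by norm_num)).differentiableAt (by norm_num)
  have hsymm : IsSymmSndFDerivAt ℝ f z := hf.isSymmSndFDerivAt (by simp)
  have key : ∀ X Y Z, fderiv ℝ w z X Y Z =
      fderiv ℝ w' (f z) (fderiv ℝ f z X) (fderiv ℝ f z Y) (fderiv ℝ f z Z)
        + w' (f z) (fderiv ℝ (fderiv ℝ f) z X Y) (fderiv ℝ f z Z)
        + w' (f z) (fderiv ℝ f z Y) (fderiv ℝ (fderiv ℝ f) z X Z) := by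
    intro X Y Z
    have h1 : HasFDerivAt (fun y => w' (f y)) (fderiv ℝ w' (f z) ∘L fderiv ℝ f z) z :=
      hw'.hasFDerivAt.comp z (hf.differentiableAt (by norm_num)).hasFDerivAt
    have h2 := (h1.clm_apply (hD.hasFDerivAt.clm_apply (hasFDerivAt_const Y z))).clm_apply
      (hD.hasFDerivAt.clm_apply (hasFDerivAt_const Z z))
    rw [← fderiv_clm_apply_two hw, Filter.EventuallyEq.fderiv_eq (h.mono fun y hy => hy Y Z),
      h2.fderiv]
    simp
    ring
  -- The terms with second derivatives of `f` cancel in pairs, by their symmetry and the skewness of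
  -- `w'`.
  rw [dTwo_apply, dTwo_apply, key, key, key, hsymm.eq Y X, hsymm.eq Z X, hsymm.eq Z Y,
    hskew (fderiv ℝ (fderiv ℝ f) z X Z), hskew (fderiv ℝ f z X) (fderiv ℝ (fderiv ℝ f) z Y Z)]
  ring

end Germs

/-! ### Transfer between fields on the manifold and the local model. -/

section Charts

variable {E : Type*} [NormedAddCommGroup E] [NormedSpace ℂ E]
  {M : Type*} [TopologicalSpace M] [ChartedSpace E M]

theorem target_mem_nhds (c : M) :
    (extChartAt 𝓘(ℝ, E) c).target ∈ 𝓝 (extChartAt 𝓘(ℝ, E) c c) :=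
  extChartAt_target_mem_nhds c

theorem chartFun_trCField [FiniteDimensional ℂ E] [IsManifold 𝓘(ℂ, E) ω M] (h : EndField E M)
    {c : M} {z : E} (hz : z ∈ (extChartAt 𝓘(ℝ, E) c).target) :
    chartFun (trCField h) c z = trC (chartEnd h c z) := by
  have h1 : chartEnd h c z = ContinuousLinearMap.inverse (chartDeriv c z) ∘L
    (endAt h ((extChartAt 𝓘(ℝ, E) c).symm z) ∘L chartDeriv c z) := rfl
  rw [h1, trC_apply, trR_comp_comm, ContinuousLinearMap.comp_assoc,
    (isInvertible_chartDeriv hz).self_comp_inverse, ContinuousLinearMap.comp_id]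
  rfl

variable [IsManifold 𝓘(ℂ, E) ω M]

theorem chartDeriv_chartEnd (h : EndField E M) {c : M} {z : E}
    (hz : z ∈ (extChartAt 𝓘(ℝ, E) c).target) (v : E) :
    chartDeriv c z (chartEnd h c z v) =
      endAt h ((extChartAt 𝓘(ℝ, E) c).symm z) (chartDeriv c z v) := by
  rw [chartEnd_apply, (isInvertible_chartDeriv hz).self_apply_inverse]

/-- Reading in a chart commutes with perturbing, so variations on `M` become the local families
already treated. -/
theorem chartMetric_vary (g : BilinField E M) (h : EndField E M) (s : ℝ) {c : M} {z : E}
    (hz : z ∈ (extChartAt 𝓘(ℝ, E) c).target) :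
    chartMetric (vary g h s) c z = perturb (chartMetric g c) (chartEnd h c) s z := by
  ext v w
  rw [perturb_apply, chartMetric_apply, chartMetric_apply, chartMetric_apply, bilinAt_vary,
    map_add (chartDeriv c z), map_add (chartDeriv c z), map_smul (chartDeriv c z),
    map_smul (chartDeriv c z), chartDeriv_chartEnd h hz, chartDeriv_chartEnd h hz]

theorem chernScal_vary_vary [FiniteDimensional ℂ E] (g : BilinField E M) (h₁ h₂ : EndField E M)
    (s t : ℝ) (x : M) : chernScal (vary (vary g h₂ t) h₁ s) x =
      chernScalLoc cplxStr (perturb (perturb (chartMetric g x) (chartEnd h₂ x) t)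
        (chartEnd h₁ x) s) (extChartAt 𝓘(ℝ, E) x x) := by
  refine chernScalLoc_congr ?_
  filter_upwards [target_mem_nhds x] with z hz
  rw [chartMetric_vary _ _ _ hz, perturb, chartMetric_vary _ _ _ hz]
  rfl

theorem chartMetric_self (g : BilinField E M) (x : M) :
    chartMetric g x (extChartAt 𝓘(ℝ, E) x x) = bilinAt g x := by
  ext v w
  rw [chartMetric_apply, chartDeriv_self, extChartAt_to_inv]
  rfl

theorem chartEnd_self (h : EndField E M) (x : M) :
    chartEnd h x (extChartAt 𝓘(ℝ, E) x x) = endAt h x := by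
  ext v
  rw [chartEnd_apply, chartDeriv_self, extChartAt_to_inv, ContinuousLinearMap.inverse_id]
  rfl

variable {g : BilinField E M} {h : EndField E M}

theorem IsHermitianMetric.isJMetricAt [FiniteDimensional ℂ E] (hg : IsHermitianMetric g) (x : M) :
    IsJMetricAt cplxStr (chartMetric g x) (extChartAt 𝓘(ℝ, E) x x) where
  symm := .of_forall fun z v w =>
    hg.symm ((extChartAt 𝓘(ℝ, E) x).symm z) (chartDeriv x z v) (chartDeriv x z w)
  inv := by
    filter_upwards [target_mem_nhds x] with z hz v w
    rw [chartMetric_apply, chartMetric_apply, chartDeriv_J hz, chartDeriv_J hz]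
    exact hg.invariant ((extChartAt 𝓘(ℝ, E) x).symm z) (chartDeriv x z v) (chartDeriv x z w)
  smooth := (contDiffAt_chartMetric hg x).of_le (WithTop.coe_le_coe.2 (le_top : (3 : ℕ∞) ≤ ⊤))
  isInvertible := by
    have : FiniteDimensional ℝ E := FiniteDimensional.complexToReal E
    refine isInvertible_of_pos fun v hv => ?_
    rw [chartMetric_self]
    exact hg.pos x v hv

theorem IsSymInvariant.isSymInvariantAt (hh : IsSymInvariant g h) (x : M) :
    IsSymInvariantAt cplxStr (chartMetric g x) (chartEnd h x) (extChartAt 𝓘(ℝ, E) x x) where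
  symm := by
    filter_upwards [target_mem_nhds x] with z hz v w
    rw [chartMetric_apply, chartMetric_apply, chartDeriv_chartEnd h hz, chartDeriv_chartEnd h hz]
    exact hh.symm ((extChartAt 𝓘(ℝ, E) x).symm z) (chartDeriv x z v) (chartDeriv x z w)
  comm := by
    filter_upwards [target_mem_nhds x] with z hz v
    apply (isInvertible_chartDeriv hz).injective
    rw [chartDeriv_J hz, chartDeriv_chartEnd h hz, chartDeriv_chartEnd h hz, chartDeriv_J hz]
    exact hh.comm ((extChartAt 𝓘(ℝ, E) x).symm z) (chartDeriv x z v)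
  smooth := (contDiffAt_chartEnd hh x).of_le (WithTop.coe_le_coe.2 (le_top : (3 : ℕ∞) ≤ ⊤))

theorem chartFun_trCField_eventuallyEq [FiniteDimensional ℂ E] (h : EndField E M) (x : M) :
    chartFun (trCField h) x =ᶠ[𝓝 (extChartAt 𝓘(ℝ, E) x x)] fun z => trC (chartEnd h x z) := by
  filter_upwards [target_mem_nhds x] with z hz
  exact chartFun_trCField h hz

theorem hess_trCField [FiniteDimensional ℂ E] (g : BilinField E M) (h : EndField E M) (x : M) :
    hess g (trCField h) x = hessLoc (V := E) (chartMetric g x) (fun z => trC (chartEnd h x z))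
      (extChartAt 𝓘(ℝ, E) x x) := by
  have h1 := chartFun_trCField_eventuallyEq h x
  rw [hess, hessLoc, hessLoc, h1.fderiv.fderiv_eq, h1.fderiv_eq]

theorem ddc_trCField [FiniteDimensional ℂ E] (h : EndField E M) (x : M) :
    ddc (E := E) (trCField h) x = ddcLoc (V := E) cplxStr (fun z => trC (chartEnd h x z))
      (extChartAt 𝓘(ℝ, E) x x) :=
  ddcLoc_congr (chartFun_trCField_eventuallyEq h x)

theorem diff_trCField [FiniteDimensional ℂ E] (hh : IsSymInvariant g h) (x : M) :
    diff (trCField h) x = fderiv ℝ (fun z => trC (chartEnd h x z)) (extChartAt 𝓘(ℝ, E) x x) := by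
  have h1 := chartFun_trCField_eventuallyEq h x
  have hd : DifferentiableAt ℝ (chartFun (trCField h) x) (extChartAt 𝓘(ℝ, E) x x) := by
    refine DifferentiableAt.congr_of_eventuallyEq ?_ h1
    exact (trC (V := E)).differentiableAt.comp _
      ((contDiffAt_chartEnd hh x).differentiableAt (by simp))
  -- Manifold differentiability asks for continuity on `M` separately; it is recovered by composing
  -- the local function with the chart.
  have hc : ContinuousAt (trCField h) x := by
    have h2 : ContinuousAt (chartFun (trCField h) x ∘ extChartAt 𝓘(ℝ, E) x) x :=
      hd.continuousAt.comp (continuousAt_extChartAt x)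
    refine h2.congr ?_
    filter_upwards [extChartAt_source_mem_nhds (I := 𝓘(ℝ, E)) x] with y hy
    simp only [Function.comp_apply, chartFun, (extChartAt 𝓘(ℝ, E) x).left_inv hy]
  have hm : MDifferentiableAt 𝓘(ℝ, E) 𝓘(ℝ, ℝ) (trCField h) x := by
    rw [mdifferentiableAt_iff]
    refine ⟨hc, ?_⟩
    rw [modelWithCornersSelf_coe, Set.range_id, differentiableWithinAt_univ]
    exact hd
  refine hm.mfderiv.trans ?_
  rw [modelWithCornersSelf_coe, Set.range_id, fderivWithin_univ]
  exact h1.fderiv_eq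

theorem fundFormLoc_skew {V : Type*} [NormedAddCommGroup V] [NormedSpace ℝ V] {J : V →L[ℝ] V}
    {G : V → V →L[ℝ] V →L[ℝ] ℝ} {z : V} (hJ : ∀ v, J (J v) = -v) (hG : IsJMetricAt J G z)
    (X Y : V) : fundFormLoc J G z X Y = -fundFormLoc J G z Y X := by
  change G z (J X) Y = -G z (J Y) X
  rw [apply_J_left hJ hG.inv_self, hG.symm_self]

/-- The chart at `c` near `z` is the chart at another point composed with a holomorphic map. -/
theorem chartMetric_coordChange (g : BilinField E M) {c d : M} {z : E}
    (hz : z ∈ (extChartAt 𝓘(ℝ, E) c).target)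
    (hd : (extChartAt 𝓘(ℝ, E) c).symm z ∈ (extChartAt 𝓘(ℝ, E) d).source) (v w : E) :
    chartMetric g c z v w =
      chartMetric g d ((extChartAt 𝓘(ℝ, E) d ∘ (extChartAt 𝓘(ℝ, E) c).symm) z)
        (fderiv ℝ (extChartAt 𝓘(ℝ, E) d ∘ (extChartAt 𝓘(ℝ, E) c).symm) z v)
        (fderiv ℝ (extChartAt 𝓘(ℝ, E) d ∘ (extChartAt 𝓘(ℝ, E) c).symm) z w) := by
  set F := extChartAt 𝓘(ℝ, E) d ∘ (extChartAt 𝓘(ℝ, E) c).symm with hF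
  have hFz : F z ∈ (extChartAt 𝓘(ℝ, E) d).target := (extChartAt 𝓘(ℝ, E) d).map_source hd
  have hinv : (extChartAt 𝓘(ℝ, E) d).symm (F z) = (extChartAt 𝓘(ℝ, E) c).symm z :=
    (extChartAt 𝓘(ℝ, E) d).left_inv hd
  have hev : (extChartAt 𝓘(ℝ, E) c).symm =ᶠ[𝓝 z] (extChartAt 𝓘(ℝ, E) d).symm ∘ F := by
    have hcont : ContinuousAt (extChartAt 𝓘(ℝ, E) c).symm z := continuousAt_extChartAt_symm'' hz
    filter_upwards [hcont ((isOpen_extChartAt_source d).mem_nhds hd)] with p hp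
    exact ((extChartAt 𝓘(ℝ, E) d).left_inv hp).symm
  have hFd : DifferentiableAt ℝ F z :=
    ((contDiffAt_coordChange hz hd).differentiableAt (by simp)).restrictScalars ℝ
  have hψ : MDifferentiableAt 𝓘(ℝ, E) 𝓘(ℝ, E) (extChartAt 𝓘(ℝ, E) d).symm (F z) := by
    have h := mdifferentiableWithinAt_extChartAt_symm (I := 𝓘(ℝ, E)) hFz
    rwa [modelWithCornersSelf_coe, Set.range_id, mdifferentiableWithinAt_univ] at h
  have hA : chartDeriv c z = chartDeriv d (F z) ∘L fderiv ℝ F z := by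
    have h1 : HasMFDerivAt 𝓘(ℝ, E) 𝓘(ℝ, E) ((extChartAt 𝓘(ℝ, E) d).symm ∘ F) z _ :=
      HasMFDerivAt.comp z hψ.hasMFDerivAt hFd.hasFDerivAt.hasMFDerivAt
    exact (h1.congr_of_eventuallyEq hev).mfderiv
  rw [chartMetric_apply, chartMetric_apply, hA, hinv]
  rfl

/-- `IsKaehler` tests each point only at the centre of its own chart, whereas the Ricci computation
needs closedness near the centre of one fixed chart. Pulling back by the holomorphic coordinate
change `F` bridges the two. -/
theorem dTwo_fundFormLoc_of_isKaehler [FiniteDimensional ℂ E] (hg : IsHermitianMetric g)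
    (hK : IsKaehler g) (x : M) : ∀ᶠ z in 𝓝 (extChartAt 𝓘(ℝ, E) x x),
      dTwo (fundFormLoc cplxStr (chartMetric g x)) z = 0 := by
  have : FiniteDimensional ℝ E := FiniteDimensional.complexToReal E
  filter_upwards [target_mem_nhds x, (hg.isJMetricAt x).eventually] with z hz hGz
  set d := (extChartAt 𝓘(ℝ, E) x).symm z with hd
  have hds : d ∈ (extChartAt 𝓘(ℝ, E) d).source := mem_extChartAt_source d
  have hF := contDiffAt_coordChange hz hds
  set F := extChartAt 𝓘(ℝ, E) d ∘ (extChartAt 𝓘(ℝ, E) x).symm with hFdef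
  have hFz : F z = extChartAt 𝓘(ℝ, E) d d := rfl
  have hGd := hg.isJMetricAt d
  rw [← hFz] at hGd
  have hdiff : ∀ {G : E → E →L[ℝ] E →L[ℝ] ℝ} {p : E}, IsJMetricAt cplxStr G p →
      DifferentiableAt ℝ (fundFormLoc cplxStr G) p := fun hG =>
    hG.differentiableAt.clm_comp (differentiableAt_const _)
  ext X Y Z
  rw [dTwo_pullback (w' := fundFormLoc cplxStr (chartMetric g d)) (f := F)
    ((hF.restrict_scalars ℝ).of_le le_top) (hdiff hGd) (fundFormLoc_skew cplxStr_cplxStr hGd) ?_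
    (hdiff hGz)]
  · have h0 := hK d
    rw [dFundForm, ← hFz] at h0
    rw [h0]
    rfl
  · have hcont : ContinuousAt (extChartAt 𝓘(ℝ, E) x).symm z := continuousAt_extChartAt_symm'' hz
    filter_upwards [hcont ((isOpen_extChartAt_source d).mem_nhds hds),
      (isOpen_extChartAt_target x).mem_nhds hz] with p hp hpt X Y
    have h1 : fundFormLoc cplxStr (chartMetric g x) p X Y =
      chartMetric g x p (cplxStr X) Y := rfl
    rw [h1, chartMetric_coordChange g hpt hp, fderiv_coordChange_J hpt hp]
    rfl

end Charts

end ChernVariation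

end

/-! ### Assembly: the chart at `x` computes every term at its centre. -/

open ChernVariation in
theorem mainTheorem6 {E : Type*} [NormedAddCommGroup E] [NormedSpace ℂ E] [FiniteDimensional ℂ E]
    {M : Type*} [TopologicalSpace M] [ChartedSpace E M] [IsManifold 𝓘(ℂ, E) ω M]
    [T2Space M] [CompactSpace M] [ConnectedSpace M]
    (g : BilinField E M) (hg : IsHermitianMetric g)
    (h₁ h₂ : EndField E M) (hh₁ : IsSymInvariant g h₁) (hh₂ : IsSymInvariant g h₂) (x : M) :
    (∀ᶠ t : ℝ in 𝓝 0,
      DifferentiableAt ℝ (fun s : ℝ => chernScal (vary (vary g h₂ t) h₁ s) x) 0) ∧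
    HasDerivAt (fun t : ℝ => chernScalVar (vary g h₂ t) h₁ x)
      (innerEndAt g x (hess g (trCField h₁) x) (h₂ x)
        + innerCovAt g x (diff (trCField h₁) x) (divLC g h₂ x - divChern g h₂ x)
        - innerCovAt g x (diff (trCField h₁) x) (lee g x ∘L h₂ x)
        + innerEndAt g x (h₁ x) (h₂ x ∘L chernRicci g x)
        - 1 / 2 * innerEndAt g x (h₁ x) (rhoInvAt g x (ddc (trCField h₂) x))) 0 ∧
    (IsKaehler g →
      HasDerivAt (fun t : ℝ => chernScalVar (vary g h₂ t) h₁ x)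
        (innerEndAt g x (hess g (trCField h₁) x) (h₂ x)
          + innerEndAt g x (h₁ x) (hess g (trCField h₂) x)
          + innerEndAt g x (h₁ x) (h₂ x ∘L ricci g x)) 0) := by
  have hJ : ∀ v : E, cplxStr (cplxStr v) = -v := cplxStr_cplxStr
  have hG := hg.isJMetricAt x
  have H₁ := hh₁.isSymInvariantAt x
  have H₂ := hh₂.isSymInvariantAt x
  have hmain := hasDerivAt_deriv_chernScalLoc hJ hG H₁ H₂
  have hvar : (fun t : ℝ => chernScalVar (vary g h₂ t) h₁ x) = fun t => deriv (fun s =>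
      chernScalLoc cplxStr (perturb (perturb (chartMetric g x) (chartEnd h₂ x) t)
        (chartEnd h₁ x) s) (extChartAt 𝓘(ℝ, E) x x)) 0 := by
    ext t
    rw [chernScalVar]
    simp only [chernScal_vary_vary]
  refine ⟨?_, ?_, fun hK => ?_⟩
  · filter_upwards [hG.eventually_perturb H₂.smooth H₂.comm] with t ht
    simp only [chernScal_vary_vary]
    exact (deriv_chernScalLoc_perturb hJ ht H₁.smooth H₁.comm).differentiableAt
  · rw [hvar]
    refine hmain.congr_deriv ?_
    rw [secondVariation_eq hJ hG H₁ H₂, chartMetric_self, chartEnd_self, chartEnd_self,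
      ← hess_trCField, ← diff_trCField hh₁, ← ddc_trCField (E := E)]
    rfl
  · rw [hvar]
    refine hmain.congr_deriv ?_
    rw [secondVariation_eq_of_kaehler hJ hG (dTwo_fundFormLoc_of_isKaehler hg hK x) H₁ H₂,
      chartMetric_self, chartEnd_self, chartEnd_self, ← hess_trCField, ← hess_trCField]
    rfl
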